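/- Let an instance of Ball-3-SAT be a triple $(F,\alpha,r)$: a CNF formula $F$ over $n$ boolean variables (a finite set of clauses, each a set of at most three literals), a truth assignment $\alpha\in\{0,1\}^n$ and $r\in\mathbb{N}$. The question is whether some $\alpha^*\in\{0,1\}^n$ that satisfies $F$ has Hamming distance at most $r$ from $\alpha$. Let $\mathrm{Neg}(F)$ be the set of clauses of $F$ all of whose literals are false under $\alpha$; for $\alpha=(1,\dots,1)$ these are the clauses that have only negative literals. A $(3,3)$-CSP formula over $m$ variables is a conjunction of constraints over $m$ variables with values in a set of three elements, where each constraint is a disjunction of at most three literals of the form $(x\neq c)$. Consider the instances $(F,\alpha,r)$ for which $\mathrm{Neg}(F)$ consists of exactly $r$ clauses, each with exactly three literals, no two of which share a variable. On these instances: (a) there is a deterministic algorithm, with running time polynomial in $n$, that outputs a $(3,3)$-CSP formula over $r$ variables which is satisfiable if and only if the answer to $(F,\alpha,r)$ is yes; (b) there is a deterministic algorithm that decides Ball-3-SAT in time $O^*(2.077^r)$, that is, in at most $p(n)\cdot 2.077^r$ steps for some polynomial $p$ that does not depend on the instance. Time is counted on a machine with pointers: programs of first-order LISP on binary trees, where one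 step is one elementary operation (read the argument, nil, cons, head, tail, test for nil, function call). -/

import Mathlib

namespace BallSat

/-! ### CNF formulas and Ball-3-SAT -/

/-- A literal over the variables `0, …, n - 1`: `(x, true)` is the positive literal `x`,
and `(x, false)` is the negative literal `x̄`. -/
abbrev Literal (n : ℕ) : Type := Fin n × Bool

/-- A clause is a finite set of literals, read as their disjunction. -/
abbrev Clause (n : ℕ) : Type := Finset (Literal n)

/-- A CNF formula is a finite set of clauses, read as their conjunction. -/
abbrev Formula (n : ℕ) : Type := Finset (Clause n)

/-- A truth assignment to `n` variables (`true` is `1`, `false` is `0`). -/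
abbrev Assignment (n : ℕ) : Type := Fin n → Bool

/-- The literal `l` is true under `α`. -/
def Literal.Holds {n : ℕ} (α : Assignment n) (l : Literal n) : Prop := α l.1 = l.2

/-- `α` satisfies the clause `C`. -/
def Clause.Holds {n : ℕ} (α : Assignment n) (C : Clause n) : Prop :=
  ∃ l ∈ C, Literal.Holds α l

/-- `α` satisfies the formula `F`. -/
def Formula.Holds {n : ℕ} (α : Assignment n) (F : Formula n) : Prop :=
  ∀ C ∈ F, Clause.Holds α C

/-- The set of variables of a clause. -/
def Clause.vbl {n : ℕ} (C : Clause n) : Finset (Fin n) := C.image Prod.fst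

/-- `F` is a `k`-CNF formula: every clause has at most `k` literals. -/
def Formula.IsCNF {n : ℕ} (k : ℕ) (F : Formula n) : Prop := ∀ C ∈ F, C.card ≤ k

open Classical in
/-- `Neg(F)`, relative to the centre `α` of the ball: the clauses all of whose literals are false
under `α`. For `α = (1, …, 1)` these are the clauses with only negative literals. -/
noncomputable def Formula.neg {n : ℕ} (α : Assignment n) (F : Formula n) : Finset (Clause n) :=
  F.filter fun C => ∀ l ∈ C, ¬ Literal.Holds α l

/-- For the all-ones assignment, `Neg(F)` is the set of clauses with only negative literals. -/
theorem Formula.mem_neg_ones {n : ℕ} (F : Formula n) (C : Clause n) :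
    C ∈ Formula.neg (fun _ => true) F ↔ C ∈ F ∧ ∀ l ∈ C, l.2 = false := by
  simp [Formula.neg, Literal.Holds]

/-- `Neg(F)` consists of exactly `r` pairwise (variable-)disjoint 3-clauses. -/
def Formula.NegDisjoint {n : ℕ} (α : Assignment n) (F : Formula n) (r : ℕ) : Prop :=
  (Formula.neg α F).card = r ∧ (∀ C ∈ Formula.neg α F, C.card = 3) ∧
    ∀ C ∈ Formula.neg α F, ∀ D ∈ Formula.neg α F, C ≠ D → Disjoint C.vbl D.vbl

/-- The question of Ball-SAT: is there an assignment that satisfies `F` and has Hamming distance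
at most `r` from `α`? -/
def InBall {n : ℕ} (F : Formula n) (α : Assignment n) (r : ℕ) : Prop :=
  ∃ β : Assignment n, Formula.Holds β F ∧ hammingDist α β ≤ r

/-! ### Constraint satisfaction problems -/

/-- A CSP formula over `m` variables with values in a set of size `d`: a finite set of
constraints. A constraint is a finite set of pairs `(x, c)`, read as the disjunction of the
literals `x ≠ c`. -/
abbrev CSP (d m : ℕ) : Type := Finset (Finset (Fin m × Fin d))

/-- Every constraint has at most `k` literals, so that `G` is a `(d, k)`-CSP formula. -/
def CSP.HasWidth {d m : ℕ} (k : ℕ) (G : CSP d m) : Prop := ∀ C ∈ G, C.card ≤ k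

/-- Some assignment of values to the variables satisfies at least one literal of each
constraint. -/
def CSP.Satisfiable {d m : ℕ} (G : CSP d m) : Prop :=
  ∃ a : Fin m → Fin d, ∀ C ∈ G, ∃ l ∈ C, a l.1 ≠ l.2

/-! ### The model of computation

Deterministic programs of first-order LISP. The data are binary trees. A program is a finite list
of (mutually recursive) functions with one argument each; evaluation is by value. The elementary
operations are: read the argument, `nil`, `cons`, head, tail, a test for `nil`, and a function
call, and each of them costs one step. Trees are passed by reference, so that each step amounts to
a constant number of pointer operations. There is no arithmetic and no comparison of trees. -/

/-- Binary trees. -/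
inductive Data : Type
  | nil : Data
  | cons : Data → Data → Data

/-- The head of a pair (`nil` for `nil`). -/
def Data.hd : Data → Data
  | .nil => .nil
  | .cons a _ => a

/-- The tail of a pair (`nil` for `nil`). -/
def Data.tl : Data → Data
  | .nil => .nil
  | .cons _ b => b

/-- Expressions, which are the bodies of functions. -/
inductive Expr : Type
  /-- the argument of the function -/
  | arg : Expr
  /-- the empty tree -/
  | nil : Expr
  /-- a new pair -/
  | cons : Expr → Expr → Expr
  /-- the head of a pair -/
  | hd : Expr → Expr
  /-- the tail of a pair -/
  | tl : Expr → Expr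
  /-- `ite c a b` is `a` if the value of `c` is a pair, and `b` if it is `nil` -/
  | ite : Expr → Expr → Expr → Expr
  /-- `call f a` applies the `f`-th function of the program to the value of `a` -/
  | call : ℕ → Expr → Expr

/-- A program: the list of the bodies of its functions. -/
abbrev Program : Type := List Expr

/-- `Evaluates P x e v t`: in a call with argument `x`, the evaluation of `e` by the program `P`
terminates with value `v` after exactly `t` steps. -/
inductive Evaluates (P : Program) : Data → Expr → Data → ℕ → Prop
  | arg (x : Data) : Evaluates P x .arg x 1
  | nil (x : Data) : Evaluates P x .nil .nil 1
  | cons {x u v : Data} {a b : Expr} {s t : ℕ} :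
      Evaluates P x a u s → Evaluates P x b v t →
        Evaluates P x (.cons a b) (.cons u v) (s + t + 1)
  | hd {x u : Data} {a : Expr} {s : ℕ} :
      Evaluates P x a u s → Evaluates P x (.hd a) u.hd (s + 1)
  | tl {x u : Data} {a : Expr} {s : ℕ} :
      Evaluates P x a u s → Evaluates P x (.tl a) u.tl (s + 1)
  | ite_cons {x u w v : Data} {c a b : Expr} {s t : ℕ} :
      Evaluates P x c (.cons u w) s → Evaluates P x a v t →
        Evaluates P x (.ite c a b) v (s + t + 1)
  | ite_nil {x v : Data} {c a b : Expr} {s t : ℕ} :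
      Evaluates P x c .nil s → Evaluates P x b v t →
        Evaluates P x (.ite c a b) v (s + t + 1)
  | call {x u v : Data} {f : ℕ} {a e : Expr} {s t : ℕ} :
      Evaluates P x a u s → P[f]? = some e → Evaluates P u e v t →
        Evaluates P x (.call f a) v (s + t + 1)

/-- `P.Outputs x v t`: started on the input `x`, the first function of the program terminates
with output `v` after exactly `t` steps. -/
def Program.Outputs (P : Program) (x v : Data) (t : ℕ) : Prop :=
  Evaluates P x (.call 0 .arg) v t

/-- Evaluation is deterministic, in its value and in its number of steps. -/
theorem Evaluates.deterministic {P : Program} {x v v' : Data} {e : Expr} {t t' : ℕ}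
    (h : Evaluates P x e v t) (h' : Evaluates P x e v' t') : v = v' ∧ t = t' := by
  induction h generalizing v' t' with
  | arg x => cases h'; exact ⟨rfl, rfl⟩
  | nil x => cases h'; exact ⟨rfl, rfl⟩
  | cons _ _ ih₁ ih₂ =>
    cases h' with
    | cons k₁ k₂ =>
      obtain ⟨rfl, rfl⟩ := ih₁ k₁
      obtain ⟨rfl, rfl⟩ := ih₂ k₂
      exact ⟨rfl, rfl⟩
  | hd _ ih =>
    cases h' with
    | hd k => obtain ⟨rfl, rfl⟩ := ih k; exact ⟨rfl, rfl⟩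
  | tl _ ih =>
    cases h' with
    | tl k => obtain ⟨rfl, rfl⟩ := ih k; exact ⟨rfl, rfl⟩
  | ite_cons _ _ ih₁ ih₂ =>
    cases h' with
    | ite_cons k₁ k₂ =>
      obtain ⟨_, rfl⟩ := ih₁ k₁
      obtain ⟨rfl, rfl⟩ := ih₂ k₂
      exact ⟨rfl, rfl⟩
    | ite_nil k₁ k₂ => exact absurd (ih₁ k₁).1 (by simp)
  | ite_nil _ _ ih₁ ih₂ =>
    cases h' with
    | ite_cons k₁ k₂ => exact absurd (ih₁ k₁).1 (by simp)
    | ite_nil k₁ k₂ =>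
      obtain ⟨_, rfl⟩ := ih₁ k₁
      obtain ⟨rfl, rfl⟩ := ih₂ k₂
      exact ⟨rfl, rfl⟩
  | call _ hf _ ih₁ ih₂ =>
    cases h' with
    | call k₁ hf' k₂ =>
      obtain ⟨rfl, rfl⟩ := ih₁ k₁
      rw [hf, Option.some.injEq] at hf'
      subst hf'
      obtain ⟨rfl, rfl⟩ := ih₂ k₂
      exact ⟨rfl, rfl⟩

/-! ### Encoding of the instances as data -/

/-- Natural numbers, in unary. -/
def encNat : ℕ → Data
  | 0 => .nil
  | k + 1 => .cons .nil (encNat k)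

/-- Truth values. -/
def encBool : Bool → Data
  | false => .nil
  | true => .cons .nil .nil

/-- Lists, given an encoding of their entries. -/
def encList {β : Type} (enc : β → Data) : List β → Data
  | [] => .nil
  | a :: l => .cons (enc a) (encList enc l)

/-- The list of lists `L` writes down the set of sets `F`, in some order and possibly with
repetitions. -/
def Lists {β : Type} [DecidableEq β] (L : List (List β)) (F : Finset (Finset β)) : Prop :=
  (L.map List.toFinset).toFinset = F

/-- The list of lists `L` writes down the set of sets `F`, in some order and without
repetitions. -/
def ListsOnce {β : Type} [DecidableEq β] (L : List (List β)) (F : Finset (Finset β)) : Prop :=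
  Lists L F ∧ (L.map List.toFinset).Nodup ∧ ∀ C ∈ L, C.Nodup

/-- The instance of Ball-SAT with `n` variables whose formula is written down as `L`. -/
def encInstance (n : ℕ) (L : List (List (Literal n))) (α : Assignment n) (r : ℕ) : Data :=
  .cons (encNat n) (.cons (encNat r) (.cons (encList encBool (List.ofFn α))
    (encList (encList fun l : Literal n => .cons (encNat l.1) (encBool l.2)) L)))

/-- The CSP formula over `m` variables that is written down as `L`. -/
def encCSP (d m : ℕ) (L : List (List (Fin m × Fin d))) : Data :=
  .cons (encNat m)
    (encList (encList fun l : Fin m × Fin d => .cons (encNat l.1) (encNat l.2)) L)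

end BallSat

/-!
An assignment at distance at most `r` from `α` that satisfies the formula has to flip a variable of
each of the `r` disjoint clauses in `Neg(F)`, hence exactly one in each and no other. What is left
to choose is which literal of the `i`-th false clause is flipped: this is the value of the `i`-th
variable of a CSP formula, and each clause of `F` forbids at most one pattern of three choices.

For the CSP formula, let the directed distance from `a` to `x` be the number of cyclic increments
`v ↦ v + 1` of single values that turn `a` into `x`. If `a` violates a constraint that `x`
satisfies, then incrementing the right one of its at most `k` variables brings `a` closer to `x`, so
all assignments within directed distance `e` of `a` are searched with `k ^ e` leaves. A greedy
choice among translates covers all assignments of `b` variables at directed distance `e` by about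
`k ^ b / B` words, where `B` is the number of assignments at that distance from one word. As the sum
of `B * k ^ (-e)` over all `e` equals `(∑ v, k ^ (-v)) ^ b`, some `e` makes the total number of
leaves about `(k / ∑ v, k ^ (-v)) ^ b`, which is `(27 / 13) ^ b` for `k = 3`. Blocks of a constant
length `b` suffice, so the code is a constant of the program and costs no time.
-/

namespace BallSat

/-! ### Evaluation in bounded time -/

/-- The trees that encode the elements of `A`, as inputs and outputs of programs. -/
class Enc (A : Type) where
  /-- the encoding -/
  enc : A → Data

open Enc (enc)

instance : Enc Data := ⟨id⟩
instance : Enc ℕ := ⟨encNat⟩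
instance : Enc Bool := ⟨encBool⟩
instance {k : ℕ} : Enc (Fin k) := ⟨fun i => encNat i⟩
instance {A : Type} [Enc A] : Enc (List A) := ⟨encList enc⟩
instance {A B : Type} [Enc A] [Enc B] : Enc (A × B) := ⟨fun p => .cons (enc p.1) (enc p.2)⟩

/-- The evaluation of `e` on the argument `x` terminates with value `v` in at most `T` steps. Bounds
compose more easily than the exact numbers of steps of `Evaluates`. -/
def EvaluatesIn (P : Program) (x : Data) (e : Expr) (v : Data) (T : ℕ) : Prop :=
  ∃ t ≤ T, Evaluates P x e v t

namespace EvaluatesIn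

variable {P : Program} {x u v w : Data} {a b c e : Expr} {S T U : ℕ}

theorem mono (h : EvaluatesIn P x e v S) (hST : S ≤ T) : EvaluatesIn P x e v T :=
  let ⟨t, ht, h⟩ := h
  ⟨t, ht.trans hST, h⟩

theorem arg : EvaluatesIn P x .arg x 1 := ⟨1, le_rfl, .arg x⟩

theorem nil : EvaluatesIn P x .nil .nil 1 := ⟨1, le_rfl, .nil x⟩

theorem cons (h : EvaluatesIn P x a u S) (k : EvaluatesIn P x b v T) :
    EvaluatesIn P x (.cons a b) (.cons u v) (S + T + 1) := by
  obtain ⟨s, hs, h⟩ := h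
  obtain ⟨t, ht, k⟩ := k
  exact ⟨_, by omega, .cons h k⟩

theorem hd (h : EvaluatesIn P x a u S) : EvaluatesIn P x (.hd a) u.hd (S + 1) := by
  obtain ⟨s, hs, h⟩ := h
  exact ⟨_, by omega, .hd h⟩

theorem tl (h : EvaluatesIn P x a u S) : EvaluatesIn P x (.tl a) u.tl (S + 1) := by
  obtain ⟨s, hs, h⟩ := h
  exact ⟨_, by omega, .tl h⟩

theorem ite_cons (h : EvaluatesIn P x c (.cons u w) S) (k : EvaluatesIn P x a v T) :
    EvaluatesIn P x (.ite c a b) v (S + T + 1) := by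
  obtain ⟨s, hs, h⟩ := h
  obtain ⟨t, ht, k⟩ := k
  exact ⟨_, by omega, .ite_cons h k⟩

theorem ite_nil (h : EvaluatesIn P x c .nil S) (k : EvaluatesIn P x b v T) :
    EvaluatesIn P x (.ite c a b) v (S + T + 1) := by
  obtain ⟨s, hs, h⟩ := h
  obtain ⟨t, ht, k⟩ := k
  exact ⟨_, by omega, .ite_nil h k⟩

theorem call {f : ℕ} (h : EvaluatesIn P x a u S) (hf : P[f]? = some e)
    (k : EvaluatesIn P u e v T) : EvaluatesIn P x (.call f a) v (S + T + 1) := by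
  obtain ⟨s, hs, h⟩ := h
  obtain ⟨t, ht, k⟩ := k
  exact ⟨_, by omega, .call h hf k⟩

theorem or {p q : Bool} (h : EvaluatesIn P x a (enc p) S) (k : EvaluatesIn P x b (enc q) T) :
    EvaluatesIn P x (.ite a (.cons .nil .nil) b) (enc (p || q)) (S + T + 4) := by
  cases p with
  | true => exact (h.ite_cons (nil.cons nil)).mono (by omega)
  | false => exact (h.ite_nil k).mono (by omega)

end EvaluatesIn

/-! ### Sizes of encodings -/

/-- The number of pairs of a tree. -/
def Data.size : Data → ℕ
  | .nil => 0
  | .cons a b => a.size + b.size + 1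

/-- The size of the encoding of `a`, which measures inputs and outputs. -/
def encSize {A : Type} [Enc A] (a : A) : ℕ := (enc a).size

section Sizes

variable {A B : Type} [Enc A] [Enc B]

@[simp] theorem enc_list_cons (a : A) (l : List A) : enc (a :: l) = .cons (enc a) (enc l) := rfl

@[simp] theorem encSize_mk (a : A) (b : B) : encSize (a, b) = encSize a + encSize b + 1 := rfl
@[simp] theorem encSize_nil : encSize ([] : List A) = 0 := rfl
@[simp] theorem encSize_cons (a : A) (l : List A) :
    encSize (a :: l) = encSize a + encSize l + 1 := rfl

theorem encSize_prod (p : A × B) : encSize p = encSize p.1 + encSize p.2 + 1 := rfl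

@[simp] theorem encSize_nat (n : ℕ) : encSize n = n := by
  induction n with
  | zero => rfl
  | succ n ih =>
    change 0 + encSize n + 1 = n + 1
    omega

@[simp] theorem encSize_fin {k : ℕ} (i : Fin k) : encSize i = i := encSize_nat i

theorem encSize_bool_le (b : Bool) : encSize b ≤ 1 := by cases b <;> decide

@[simp] theorem encSize_append (l l' : List A) :
    encSize (l ++ l') = encSize l + encSize l' := by
  induction l with
  | nil => simp
  | cons a l ih => simp only [List.cons_append, encSize_cons, ih]; omega

theorem encSize_le_of_suffix {l l' : List A} (h : l' <:+ l) : encSize l' ≤ encSize l := by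
  obtain ⟨t, rfl⟩ := h
  simp

theorem encSize_le_of_mem {a : A} {l : List A} (h : a ∈ l) : encSize a ≤ encSize l := by
  obtain ⟨s, t, rfl⟩ := List.append_of_mem h
  simp only [encSize_append, encSize_cons]
  omega

theorem length_le_encSize (l : List A) : l.length ≤ encSize l := by
  induction l with
  | nil => simp
  | cons a l ih => simp only [List.length_cons, encSize_cons]; omega

theorem encSize_le_length_mul {l : List A} {M : ℕ} (h : ∀ a ∈ l, encSize a ≤ M) :
    encSize l ≤ l.length * (M + 1) := by
  induction l with
  | nil => simp
  | cons a l ih =>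
    obtain ⟨ha, hl⟩ := List.forall_mem_cons.1 h
    have := ih hl
    simp only [encSize_cons, List.length_cons, Nat.succ_mul]
    omega

end Sizes

/-! ### Polynomial bounds -/

theorem eval_le_eval (p : Polynomial ℕ) {m n : ℕ} (h : m ≤ n) : p.eval m ≤ p.eval n := by
  simp only [Polynomial.eval_eq_sum]
  exact Finset.sum_le_sum fun i _ => Nat.mul_le_mul_left _ (Nat.pow_le_pow_left h i)

/-- The values of `g` are bounded by a polynomial in the values of `m`. -/
def PolyBounded {A : Type} (m g : A → ℕ) : Prop := ∃ p : Polynomial ℕ, ∀ a, g a ≤ p.eval (m a)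

namespace PolyBounded

variable {A B : Type} {m g h : A → ℕ}

theorem refl (m : A → ℕ) : PolyBounded m m := ⟨.X, fun a => by simp⟩

theorem const (m : A → ℕ) (c : ℕ) : PolyBounded m fun _ => c := ⟨.C c, fun a => by simp⟩

theorem of_le (hh : PolyBounded m h) (hgh : ∀ a, g a ≤ h a) : PolyBounded m g :=
  let ⟨p, hp⟩ := hh
  ⟨p, fun a => (hgh a).trans (hp a)⟩

theorem add (hg : PolyBounded m g) (hh : PolyBounded m h) : PolyBounded m fun a => g a + h a :=
  let ⟨p, hp⟩ := hg
  let ⟨q, hq⟩ := hh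
  ⟨p + q, fun a => by simpa using Nat.add_le_add (hp a) (hq a)⟩

theorem mul (hg : PolyBounded m g) (hh : PolyBounded m h) : PolyBounded m fun a => g a * h a :=
  let ⟨p, hp⟩ := hg
  let ⟨q, hq⟩ := hh
  ⟨p * q, fun a => by simpa using Nat.mul_le_mul (hp a) (hq a)⟩

theorem eval (hg : PolyBounded m g) (q : Polynomial ℕ) : PolyBounded m fun a => q.eval (g a) :=
  let ⟨p, hp⟩ := hg
  ⟨q.comp p, fun a => by simpa using eval_le_eval q (hp a)⟩

theorem trans (hg : PolyBounded m g) (hh : PolyBounded g h) : PolyBounded m h :=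
  let ⟨q, hq⟩ := hh
  (hg.eval q).of_le hq

theorem comp {m' g' : B → ℕ} (h : PolyBounded m' g') (f : A → B) :
    PolyBounded (fun a => m' (f a)) fun a => g' (f a) :=
  let ⟨p, hp⟩ := h
  ⟨p, fun a => hp (f a)⟩

end PolyBounded

/-! ### Functions computed in bounded time -/

/-- Programs compute `f` in at most `T a` steps on the input `a`. So that the functions of several
programs can be put together, the functions `Q` that the expression `e` may call are placed at an
arbitrary position `n`, in any program `P` that has them there. -/
def ComputableInTime {A B : Type} [Enc A] [Enc B] (f : A → B) (T : A → ℕ) : Prop :=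
  ∀ n : ℕ, ∃ (Q : Program) (e : Expr), ∀ P : Program, Q <+: P.drop n →
    ∀ a : A, EvaluatesIn P (enc a) e (enc (f a)) (T a)

theorem append_prefix_drop {α : Type*} {Q Q' P : List α} {n : ℕ} :
    Q ++ Q' <+: P.drop n ↔ Q <+: P.drop n ∧ Q' <+: P.drop (n + Q.length) := by
  rw [← List.drop_drop]
  constructor
  · rintro ⟨t, ht⟩
    rw [← ht, List.append_assoc, List.drop_left]
    exact ⟨List.prefix_append _ _, List.prefix_append _ _⟩
  · rintro ⟨⟨t, ht⟩, h⟩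
    rw [← ht, List.drop_left] at h
    rw [← ht]
    exact (List.prefix_append_right_inj Q).2 h

theorem getElem?_of_singleton_prefix_drop {α : Type*} {P : List α} {n : ℕ} {e : α}
    (h : [e] <+: P.drop n) : P[n]? = some e := by
  obtain ⟨t, ht⟩ := h
  simpa [← ht] using (List.getElem?_drop (xs := P) (i := n) (j := 0)).symm

namespace ComputableInTime

variable {A B C D : Type} [Enc A] [Enc B] [Enc C] [Enc D]

theorem mono {f : A → B} {T U : A → ℕ} (h : ComputableInTime f T) (hTU : ∀ a, T a ≤ U a) :
    ComputableInTime f U := fun n =>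
  let ⟨Q, e, h⟩ := h n
  ⟨Q, e, fun P hP a => (h P hP a).mono (hTU a)⟩

theorem of_enc_eq {f : A → B} {g : A → C} {T : A → ℕ} (h : ComputableInTime f T)
    (hfg : ∀ a, enc (g a) = enc (f a)) : ComputableInTime g T := fun n =>
  let ⟨Q, e, h⟩ := h n
  ⟨Q, e, fun P hP a => hfg a ▸ h P hP a⟩

theorem of_expr {f : A → B} {T : A → ℕ} (e : Expr)
    (h : ∀ P a, EvaluatesIn P (enc a) e (enc (f a)) (T a)) : ComputableInTime f T :=
  fun _ => ⟨[], e, fun P _ => h P⟩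

theorem exists_call {f : A → B} {T : A → ℕ} (h : ComputableInTime f T) (n : ℕ) :
    ∃ (Q : Program) (i : ℕ), ∀ P : Program, Q <+: P.drop n → ∀ {x d S a},
      EvaluatesIn P x d (enc a) S → EvaluatesIn P x (.call i d) (enc (f a)) (S + T a + 1) := by
  obtain ⟨Q, e, h⟩ := h n
  refine ⟨Q ++ [e], n + Q.length, fun P hP x d S a hd => ?_⟩
  obtain ⟨hQ, he⟩ := append_prefix_drop.1 hP
  exact hd.call (getElem?_of_singleton_prefix_drop he) (h P hQ a)

theorem map_expr {f : A → B} {g : A → C} {T : A → ℕ} (E : Expr → Expr) (c : ℕ)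
    (hE : ∀ P x e a t, EvaluatesIn P x e (enc (f a)) t →
      EvaluatesIn P x (E e) (enc (g a)) (t + c))
    (h : ComputableInTime f T) : ComputableInTime g fun a => T a + c := fun n =>
  let ⟨Q, e, h⟩ := h n
  ⟨Q, E e, fun P hP a => hE _ _ _ _ _ (h P hP a)⟩

theorem prodMk {f : A → B} {g : A → C} {T U : A → ℕ} (hf : ComputableInTime f T)
    (hg : ComputableInTime g U) :
    ComputableInTime (fun a => (f a, g a)) fun a => T a + U a + 1 := by
  intro n
  obtain ⟨Q, e, hf⟩ := hf n
  obtain ⟨Q', e', hg⟩ := hg (n + Q.length)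
  refine ⟨Q ++ Q', .cons e e', fun P hP a => ?_⟩
  obtain ⟨hQ, hQ'⟩ := append_prefix_drop.1 hP
  exact (hf P hQ a).cons (hg P hQ' a)

theorem comp {f : A → B} {g : B → C} {T : A → ℕ} {U : B → ℕ} (hg : ComputableInTime g U)
    (hf : ComputableInTime f T) :
    ComputableInTime (fun a => g (f a)) fun a => T a + U (f a) + 1 := by
  intro n
  obtain ⟨Q, e, hf⟩ := hf n
  obtain ⟨Q', i, hg⟩ := hg.exists_call (n + Q.length)
  refine ⟨Q ++ Q', .call i e, fun P hP a => ?_⟩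
  obtain ⟨hQ, hQ'⟩ := append_prefix_drop.1 hP
  exact hg P hQ' (hf P hQ a)

theorem cond {c : A → Bool} {f g : A → B} {S T U : A → ℕ} (hc : ComputableInTime c S)
    (hf : ComputableInTime f T) (hg : ComputableInTime g U) :
    ComputableInTime (fun a => bif c a then f a else g a) fun a => S a + T a + U a + 1 := by
  intro n
  obtain ⟨Q, e, hc⟩ := hc n
  obtain ⟨Q', e', hf⟩ := hf (n + Q.length)
  obtain ⟨Q'', e'', hg⟩ := hg (n + Q.length + Q'.length)
  refine ⟨Q ++ (Q' ++ Q''), .ite e e' e'', fun P hP a => ?_⟩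
  simp only [append_prefix_drop] at hP
  obtain ⟨hQ, hQ', hQ''⟩ := hP
  have hc := hc P hQ a
  dsimp only
  cases h : c a with
  | true => rw [h] at hc; exact (hc.ite_cons (hf P hQ' a)).mono (by omega)
  | false => rw [h] at hc; exact (hc.ite_nil (hg P hQ'' a)).mono (by omega)

theorem foldr {f : A → B → C → C} {i : A → C} {l : A → List B} {T : A × B × C → ℕ}
    {U V M : A → ℕ} (hl : ComputableInTime l V) (hi : ComputableInTime i U)
    (hf : ComputableInTime (fun p : A × B × C => f p.1 p.2.1 p.2.2) T)
    (hM : ∀ a b l', b :: l' <:+ l a → T (a, b, l'.foldr (f a) (i a)) ≤ M a) :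
    ComputableInTime (fun a => (l a).foldr (f a) (i a))
      fun a => V a + (l a).length * (M a + 18) + U a + 9 := by
  intro n
  obtain ⟨Q, e, hl⟩ := hl n
  obtain ⟨Q', i', hi⟩ := hi.exists_call (n + Q.length)
  obtain ⟨Q'', f', hf⟩ := hf.exists_call (n + Q.length + Q'.length)
  let k := n + Q.length + Q'.length + Q''.length
  let body : Expr := .ite (.tl .arg) (.call f' (.cons (.hd .arg) (.cons (.hd (.tl .arg))
    (.call k (.cons (.hd .arg) (.tl (.tl .arg))))))) (.call i' (.hd .arg))
  refine ⟨Q ++ (Q' ++ (Q'' ++ [body])), .call k (.cons .arg e), fun P hP a => ?_⟩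
  simp only [append_prefix_drop] at hP
  obtain ⟨hQ, hQ', hQ'', hk⟩ := hP
  have hk : P[k]? = some body := getElem?_of_singleton_prefix_drop hk
  have hbody : ∀ l', l' <:+ l a → EvaluatesIn P (.cons (enc a) (enc l')) body
      (enc (l'.foldr (f a) (i a))) (l'.length * (M a + 18) + U a + 6) := by
    intro l' hl'
    induction l' with
    | nil =>
      exact (EvaluatesIn.arg.tl.ite_nil (hi P hQ' EvaluatesIn.arg.hd)).mono (by simp; omega)
    | cons b l' ih =>
      have hrec := (EvaluatesIn.cons (x := .cons (enc a) (enc (b :: l'))) (.hd .arg)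
        (.tl (.tl .arg))).call hk
        (ih ((List.suffix_cons b l').trans hl'))
      have hstep := hf P hQ'' (a := (a, b, l'.foldr (f a) (i a)))
        (EvaluatesIn.cons (x := .cons (enc a) (enc (b :: l'))) (.hd .arg)
          (.cons (.hd (.tl .arg)) hrec))
      refine (EvaluatesIn.arg.tl.ite_cons hstep).mono ?_
      have := hM a b l' hl'
      simp only [List.length_cons, Nat.succ_mul]
      omega
  exact ((EvaluatesIn.arg.cons (hl P hQ a)).call hk (hbody _ List.suffix_rfl)).mono (by
    dsimp only; omega)

end ComputableInTime

/-! ### Functions computed in polynomial time -/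

/-- `f` is computed in polynomial time and has values of polynomial size. The bound on the size does
not follow from the bound on the time, since a tree that is built in few steps may contain the same
subtree many times. -/
@[fun_prop]
def PolyTime {A B : Type} [Enc A] [Enc B] (f : A → B) : Prop :=
  PolyBounded (encSize (A := A)) (fun a => encSize (f a)) ∧
    ∃ T, PolyBounded (encSize (A := A)) T ∧ ComputableInTime f T

namespace PolyTime

variable {A B C D : Type} [Enc A] [Enc B] [Enc C] [Enc D]

theorem of_enc_eq {f : A → B} {g : A → C} (h : PolyTime f) (hfg : ∀ a, enc (g a) = enc (f a)) :
    PolyTime g := by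
  obtain ⟨h, T, hT, hf⟩ := h
  exact ⟨h.of_le fun a => by simp only [encSize, hfg, le_refl], T, hT, hf.of_enc_eq hfg⟩

theorem of_eq {f g : A → B} (h : PolyTime f) (hfg : ∀ a, g a = f a) : PolyTime g :=
  h.of_enc_eq fun a => congrArg enc (hfg a)

theorem map_expr {f : A → B} {g : A → C} (h : PolyTime f) (E : Expr → Expr) (c : ℕ)
    (hsize : ∀ a, encSize (g a) ≤ encSize (f a) + c)
    (hE : ∀ P x e a t, EvaluatesIn P x e (enc (f a)) t →
      EvaluatesIn P x (E e) (enc (g a)) (t + c)) : PolyTime g := by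
  obtain ⟨h, T, hT, hf⟩ := h
  exact ⟨(h.add (.const _ c)).of_le hsize, _, hT.add (.const _ c), hf.map_expr E c hE⟩

@[fun_prop]
theorem id : PolyTime fun a : A => a :=
  ⟨.refl _, _, .const _ 1, .of_expr .arg fun _ _ => .arg⟩

@[fun_prop]
theorem const (b : B) : PolyTime fun _ : A => b := by
  refine ⟨.const _ _, ?_⟩
  suffices ∀ d : Data, ∃ T, ComputableInTime (fun _ : A => d) fun _ => T by
    obtain ⟨T, h⟩ := this (enc b)
    exact ⟨_, .const _ T, h.of_enc_eq fun _ => rfl⟩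
  intro d
  induction d with
  | nil => exact ⟨1, .of_expr .nil fun _ _ => .nil⟩
  | cons u v ihu ihv =>
    obtain ⟨S, hu⟩ := ihu
    obtain ⟨T, hv⟩ := ihv
    exact ⟨_, (hu.prodMk hv).of_enc_eq fun _ => rfl⟩

@[fun_prop]
theorem comp {g : B → C} {f : A → B} (hg : PolyTime g) (hf : PolyTime f) :
    PolyTime fun a => g (f a) := by
  obtain ⟨hf, T, hT, hf'⟩ := hf
  obtain ⟨hg, U, hU, hg'⟩ := hg
  exact ⟨hf.trans (hg.comp f), _, (hT.add (hf.trans (hU.comp f))).add (.const _ 1), hg'.comp hf'⟩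

@[fun_prop]
theorem fst {f : A → B × C} (hf : PolyTime f) : PolyTime fun a => (f a).1 :=
  hf.map_expr .hd 1 (fun a => by rw [encSize_prod (f a)]; omega) fun _ _ _ _ _ h => h.hd

@[fun_prop]
theorem snd {f : A → B × C} (hf : PolyTime f) : PolyTime fun a => (f a).2 :=
  hf.map_expr .tl 1 (fun a => by rw [encSize_prod (f a)]; omega) fun _ _ _ _ _ h => h.tl

@[fun_prop]
theorem prodMk {f : A → B} {g : A → C} (hf : PolyTime f) (hg : PolyTime g) :
    PolyTime fun a => (f a, g a) := by
  obtain ⟨hf, T, hT, hf'⟩ := hf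
  obtain ⟨hg, U, hU, hg'⟩ := hg
  exact ⟨(hf.add hg).add (.const _ 1), _, (hT.add hU).add (.const _ 1), hf'.prodMk hg'⟩

@[fun_prop]
theorem cond {c : A → Bool} {f g : A → B} (hc : PolyTime c) (hf : PolyTime f)
    (hg : PolyTime g) : PolyTime fun a => bif c a then f a else g a := by
  obtain ⟨-, S, hS, hc'⟩ := hc
  obtain ⟨hf, T, hT, hf'⟩ := hf
  obtain ⟨hg, U, hU, hg'⟩ := hg
  refine ⟨(hf.add hg).of_le fun a => ?_, _, ((hS.add hT).add hU).add (.const _ 1),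
    hc'.cond hf' hg'⟩
  dsimp only
  cases c a <;> simp

theorem foldr {f : A → B → C → C} {i : A → C} {l : A → List B} {S : A → ℕ}
    (hf : PolyTime fun p : A × B × C => f p.1 p.2.1 p.2.2) (hi : PolyTime i) (hl : PolyTime l)
    (hS : PolyBounded (encSize (A := A)) S)
    (hfS : ∀ a l', l' <:+ l a → encSize (l'.foldr (f a) (i a)) ≤ S a) :
    PolyTime fun a => (l a).foldr (f a) (i a) := by
  obtain ⟨hl, V, hV, hl'⟩ := hl
  obtain ⟨-, U, hU, hi'⟩ := hi
  obtain ⟨-, T, ⟨p, hT⟩, hf'⟩ := hf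
  let M : A → ℕ := fun a => p.eval (encSize a + encSize (l a) + S a + 2)
  have hM : PolyBounded (encSize (A := A)) M :=
    ((((PolyBounded.refl _).add hl).add hS).add (.const _ 2)).eval p
  have hTM : ∀ a b l', b :: l' <:+ l a → T (a, b, l'.foldr (f a) (i a)) ≤ M a := by
    intro a b l' hl'
    refine (hT _).trans (eval_le_eval p ?_)
    have hb : encSize b ≤ encSize (l a) := encSize_le_of_mem (hl'.subset (by simp))
    have hl' := hfS a l' ((List.suffix_cons b l').trans hl')
    simp only [encSize_mk]
    omega
  refine ⟨hS.of_le fun a => hfS a _ List.suffix_rfl, _, ?_, hl'.foldr hi' hf' hTM⟩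
  exact ((hV.add ((hl.of_le fun a => length_le_encSize (l a)).mul (hM.add (.const _ 18)))).add
    hU).add (.const _ 9)

theorem foldr_of_encSize_le_add {f : A → B → C → C} {i : A → C} {l : A → List B} {D : A × B → ℕ}
    (hf : PolyTime fun p : A × B × C => f p.1 p.2.1 p.2.2) (hi : PolyTime i) (hl : PolyTime l)
    (hD : PolyBounded (encSize (A := A × B)) D)
    (hfD : ∀ a b c, encSize (f a b c) ≤ encSize c + D (a, b)) :
    PolyTime fun a => (l a).foldr (f a) (i a) := by
  obtain ⟨p, hD⟩ := hD
  let M : A → ℕ := fun a => p.eval (encSize a + encSize (l a) + 1)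
  have hM : PolyBounded (encSize (A := A)) M :=
    (((PolyBounded.refl _).add hl.1).add (.const _ 1)).eval p
  refine foldr hf hi hl (S := fun a => encSize (i a) + encSize (l a) * M a)
    (hi.1.add (hl.1.mul hM)) fun a l' hl' => ?_
  have hfoldr : encSize (l'.foldr (f a) (i a)) ≤ encSize (i a) + l'.length * M a := by
    induction l' with
    | nil => simp
    | cons b l' ih =>
      have ih := ih ((List.suffix_cons b l').trans hl')
      have hDM : D (a, b) ≤ M a := by
        refine (hD _).trans (eval_le_eval p ?_)
        have hb : encSize b ≤ encSize (l a) := encSize_le_of_mem (hl'.subset (by simp))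
        simp only [encSize_mk]
        omega
      have := hfD a b (l'.foldr (f a) (i a))
      simp only [List.foldr_cons, List.length_cons, Nat.succ_mul]
      omega
  have := Nat.mul_le_mul_right (M a) ((length_le_encSize l').trans (encSize_le_of_suffix hl'))
  omega

/-! ### Truth values and lists -/

@[fun_prop]
theorem not {f : A → Bool} (hf : PolyTime f) : PolyTime fun a => !f a :=
  (hf.cond (const false) (const true)).of_eq fun a => by cases f a <;> rfl

@[fun_prop]
theorem and {f g : A → Bool} (hf : PolyTime f) (hg : PolyTime g) :
    PolyTime fun a => f a && g a :=
  (hf.cond hg (const false)).of_eq fun a => by cases f a <;> rfl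

@[fun_prop]
theorem bool_beq {f g : A → Bool} (hf : PolyTime f) (hg : PolyTime g) :
    PolyTime fun a => f a == g a :=
  (hf.cond hg hg.not).of_eq fun a => by cases f a <;> cases g a <;> rfl

@[fun_prop]
theorem cons {f : A → B} {g : A → List B} (hf : PolyTime f) (hg : PolyTime g) :
    PolyTime fun a => f a :: g a :=
  (hf.prodMk hg).of_enc_eq fun _ => rfl

@[fun_prop]
theorem tail {f : A → List B} (hf : PolyTime f) : PolyTime fun a => (f a).tail := by
  refine hf.map_expr .tl 1
    (fun a => (encSize_le_of_suffix (List.tail_suffix (f a))).trans (Nat.le_succ _))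
    fun P x e a t h => ?_
  have h := h.tl
  cases hfa : f a <;> rwa [hfa] at h

@[fun_prop]
theorem isEmpty {f : A → List B} (hf : PolyTime f) : PolyTime fun a => (f a).isEmpty := by
  refine hf.map_expr (fun e => .ite e .nil (.cons .nil .nil)) 4
    (fun a => (encSize_bool_le _).trans (by omega)) fun P x e a t h => ?_
  cases hfa : f a with
  | nil => rw [hfa] at h; exact (h.ite_nil (.cons .nil .nil)).mono (by omega)
  | cons b l => rw [hfa] at h; exact (h.ite_cons .nil).mono (by omega)

@[fun_prop]
theorem headD {f : A → List B} {b : A → B} (hf : PolyTime f) (hb : PolyTime b) :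
    PolyTime fun a => (f a).headD (b a) := by
  have h : PolyTime fun a => (enc (f a)).hd := by
    refine hf.map_expr .hd 1 (fun a => ?_) fun P x e a t h => h.hd
    cases f a with
    | nil => exact Nat.zero_le _
    | cons b l =>
      change encSize b ≤ encSize (b :: l) + 1
      simp only [encSize_cons]
      omega
  refine (hf.isEmpty.cond (hb.of_enc_eq (g := fun a => enc (b a)) fun a => rfl) h).of_enc_eq
    fun a => ?_
  cases f a <;> rfl

@[fun_prop]
theorem map {l : A → List B} {f : A → B → C} (hf : PolyTime fun p : A × B => f p.1 p.2)
    (hl : PolyTime l) : PolyTime fun a => (l a).map (f a) := by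
  refine (foldr_of_encSize_le_add (f := fun a b c => f a b :: c) ?_ (const []) hl
    (hf.1.add (.const _ 1)) fun a b c => ?_).of_eq fun a => List.map_eq_foldr
  · exact (hf.comp (id.fst.prodMk id.snd.fst)).cons id.snd.snd
  · simp only [encSize_cons]; omega

@[fun_prop]
theorem append {f g : A → List B} (hf : PolyTime f) (hg : PolyTime g) :
    PolyTime fun a => f a ++ g a := by
  refine (foldr_of_encSize_le_add (f := fun _ b c => b :: c) (by fun_prop) hg hf
    (id.snd.1.add (.const _ 1)) fun a b c => ?_).of_eq fun a => by rw [List.foldr_cons_eq_append']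
  simp only [encSize_cons]; omega

@[fun_prop]
theorem flatten {f : A → List (List B)} (hf : PolyTime f) : PolyTime fun a => (f a).flatten := by
  refine (foldr_of_encSize_le_add (f := fun _ b c => b ++ c) (by fun_prop) (const []) hf
    id.snd.1 fun a b c => ?_).of_eq fun a => ?_
  · simp only [encSize_append]; omega
  · induction f a <;> simp_all

@[fun_prop]
theorem flatMap {l : A → List B} {f : A → B → List C} (hf : PolyTime fun p : A × B => f p.1 p.2)
    (hl : PolyTime l) : PolyTime fun a => (l a).flatMap (f a) :=
  (hf.map hl).flatten.of_eq fun _ => List.flatMap_def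

@[fun_prop]
theorem filter {l : A → List B} {f : A → B → Bool} (hf : PolyTime fun p : A × B => f p.1 p.2)
    (hl : PolyTime l) : PolyTime fun a => (l a).filter (f a) := by
  refine (flatMap (f := fun a b => bif f a b then [b] else []) (by fun_prop) hl).of_eq fun a => ?_
  induction l a with
  | nil => rfl
  | cons b l ih => cases h : f a b <;> simp [h, ih]

@[fun_prop]
theorem all {l : A → List B} {f : A → B → Bool} (hf : PolyTime fun p : A × B => f p.1 p.2)
    (hl : PolyTime l) : PolyTime fun a => (l a).all (f a) :=
  (filter (f := fun a b => !f a b) hf.not hl).isEmpty.of_eq fun a => by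
    rw [Bool.eq_iff_iff]
    simp [List.filter_eq_nil_iff]

/-! ### Natural numbers -/

theorem enc_replicate_nil (n : ℕ) : enc (List.replicate n Data.nil) = enc n := by
  induction n with
  | zero => rfl
  | succ n ih => rw [List.replicate_succ, enc_list_cons, ih]; rfl

theorem replicate_nil {f : A → ℕ} (hf : PolyTime f) :
    PolyTime fun a => List.replicate (f a) Data.nil :=
  hf.of_enc_eq fun _ => enc_replicate_nil _

@[fun_prop]
theorem length {f : A → List B} (hf : PolyTime f) : PolyTime fun a => (f a).length :=
  (map (f := fun _ _ => Data.nil) (by fun_prop) hf).of_enc_eq fun a => by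
    rw [List.map_const', enc_replicate_nil]

@[fun_prop]
theorem nat_add {f g : A → ℕ} (hf : PolyTime f) (hg : PolyTime g) : PolyTime fun a => f a + g a :=
  (hf.replicate_nil.append hg.replicate_nil).length.of_eq fun a => by simp

@[fun_prop]
theorem drop {f : A → ℕ} {g : A → List B} (hf : PolyTime f) (hg : PolyTime g) :
    PolyTime fun a => (g a).drop (f a) := by
  refine (foldr_of_encSize_le_add (f := fun _ _ c => c.tail) (by fun_prop) hg hf.replicate_nil
    (.const _ 0) fun _ _ c => encSize_le_of_suffix (List.tail_suffix c)).of_eq fun a => ?_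
  rw [List.foldr_const, List.length_replicate]
  induction f a with
  | zero => rfl
  | succ n ih => rw [Function.iterate_succ_apply', ← ih, List.tail_drop]

@[fun_prop]
theorem nat_sub {f g : A → ℕ} (hf : PolyTime f) (hg : PolyTime g) : PolyTime fun a => f a - g a :=
  (hg.drop hf.replicate_nil).length.of_eq fun a => by simp

theorem eq_zero {f : A → ℕ} (hf : PolyTime f) : PolyTime fun a => f a == 0 :=
  hf.replicate_nil.isEmpty.of_eq fun a => by cases f a <;> rfl

@[fun_prop]
theorem nat_ble {f g : A → ℕ} (hf : PolyTime f) (hg : PolyTime g) :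
    PolyTime fun a => Nat.ble (f a) (g a) :=
  (hf.nat_sub hg).eq_zero.of_eq fun a => by
    rw [Bool.eq_iff_iff]
    simp [Nat.sub_eq_zero_iff_le]

@[fun_prop]
theorem nat_beq {f g : A → ℕ} (hf : PolyTime f) (hg : PolyTime g) :
    PolyTime fun a => f a == g a :=
  ((hf.nat_ble hg).and (hg.nat_ble hf)).of_eq fun a => by
    rw [Bool.eq_iff_iff]
    simp only [beq_iff_eq, Bool.and_eq_true, Nat.ble_eq]
    exact le_antisymm_iff

@[fun_prop]
theorem getD {f : A → List B} {g : A → ℕ} {b : A → B} (hf : PolyTime f) (hg : PolyTime g)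
    (hb : PolyTime b) : PolyTime fun a => (f a).getD (g a) (b a) :=
  ((hg.drop hf).headD hb).of_eq fun a => by
    rw [List.headD_eq_head?_getD, List.head?_drop, List.getD_eq_getElem?_getD]

@[fun_prop]
theorem range {f : A → ℕ} (hf : PolyTime f) : PolyTime fun a => List.range (f a) := by
  have hrange (l : List Data) : l.foldr (fun _ c => c ++ [c.length]) [] = List.range l.length := by
    induction l with
    | nil => rfl
    | cons d l ih => simp [ih, List.range_succ]
  refine (foldr (f := fun _ _ c => c ++ [c.length]) (by fun_prop) (const []) hf.replicate_nil
    (hf.1.mul (hf.1.add (.const _ 1))) fun a l hl => ?_).of_eq fun a => by simp [hrange]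
  have hl : l.length ≤ f a := by simpa using hl.length_le
  rw [hrange, encSize_nat]
  refine (encSize_le_length_mul fun i hi => ?_).trans
    (Nat.mul_le_mul (List.length_range.trans_le hl) le_rfl)
  rw [encSize_nat]
  exact (List.mem_range.1 hi).le.trans hl

@[fun_prop]
theorem set {f : A → List B} {g : A → ℕ} {b : A → B} (hf : PolyTime f) (hg : PolyTime g)
    (hb : PolyTime b) : PolyTime fun a => (f a).set (g a) (b a) := by
  have h : PolyTime fun a => (List.range (f a).length).map fun i =>
    bif i == g a then b a else (f a).getD i (b a) := by fun_prop
  refine h.of_eq fun a => List.ext_getElem (by simp) fun i hi _ => ?_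
  rw [List.length_set] at hi
  by_cases hig : i = g a
  · simp [hig]
  · simp [Ne.symm hig, beq_eq_false_iff_ne.2 hig, hi]

@[fun_prop]
theorem fin_val {k : ℕ} {f : A → Fin k} (hf : PolyTime f) : PolyTime fun a => (f a : ℕ) :=
  hf.of_enc_eq fun _ => rfl

@[fun_prop]
theorem fin_beq {k : ℕ} {f g : A → Fin k} (hf : PolyTime f) (hg : PolyTime g) :
    PolyTime fun a => f a == g a :=
  (hf.fin_val.nat_beq hg.fin_val).of_eq fun a => by
    rw [Bool.eq_iff_iff]
    simp [Fin.ext_iff]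

theorem comp_fin {k : ℕ} (g : Fin k → B) {f : A → Fin k} (hf : PolyTime f) :
    PolyTime fun a => g (f a) := by
  have h : PolyTime fun a => (List.ofFn fun i => enc (g i)).getD (f a) .nil :=
    (const _).getD hf.fin_val (const _)
  exact h.of_enc_eq fun a => by simp; rfl

end PolyTime

/-! ### Flipping one variable of each false clause -/

section Flip

variable {n : ℕ}

/-- The assignment obtained from `α` by flipping the variables in `S`. -/
def Assignment.flip (α : Assignment n) (S : Finset (Fin n)) : Assignment n :=
  fun x => if x ∈ S then !α x else α x

theorem Literal.holds_flip (α : Assignment n) (S : Finset (Fin n)) (l : Literal n) :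
    Literal.Holds (α.flip S) l ↔ (Literal.Holds α l ↔ l.1 ∉ S) := by
  simp only [Literal.Holds, Assignment.flip]
  by_cases hS : l.1 ∈ S <;> cases α l.1 <;> cases l.2 <;> simp [hS]

theorem Assignment.hammingDist_flip (α : Assignment n) (S : Finset (Fin n)) :
    hammingDist α (α.flip S) = S.card := by
  have h : ({x | α x ≠ α.flip S x} : Finset (Fin n)) = S := by
    ext x
    by_cases hx : x ∈ S <;> simp [Assignment.flip, hx]
  rw [hammingDist, h]

theorem Assignment.flip_filter_ne (α β : Assignment n) : α.flip {x | α x ≠ β x} = β := by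
  funext x
  by_cases hx : α x = β x
  · simp [Assignment.flip, hx]
  · simpa [Assignment.flip, hx] using (Bool.eq_not.2 (Ne.symm hx)).symm

theorem inBall_iff_exists_holds_flip {ι κ : Type*} [Fintype ι] {F : Formula n} {α : Assignment n}
    {X : ι → κ → Fin n} (hX : ∀ i i' j j', X i j = X i' j' → i = i')
    (hXF : ∀ i, ∃ C ∈ F, ∀ l ∈ C, (∃ j, X i j = l.1) ∧ ¬ Literal.Holds α l) :
    InBall F α (Fintype.card ι) ↔
      ∃ A : ι → κ, F.Holds (α.flip (Finset.univ.image fun i => X i (A i))) := by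
  constructor
  · rintro ⟨β, hβ, hdist⟩
    have hdiff (i : ι) : ∃ j, α (X i j) ≠ β (X i j) := by
      obtain ⟨C, hC, hfalse⟩ := hXF i
      obtain ⟨l, hl, hlβ⟩ := hβ C hC
      obtain ⟨⟨j, hj⟩, hlα⟩ := hfalse l hl
      exact ⟨j, fun h => hlα (by rw [Literal.Holds, ← hj, h, hj, hlβ])⟩
    choose A hA using hdiff
    have hsub : Finset.univ.image (fun i => X i (A i)) ⊆ ({x | α x ≠ β x} : Finset (Fin n)) :=
      Finset.image_subset_iff.2 fun i _ => (Finset.mem_filter_univ _).2 (hA i)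
    have hcard : (Finset.univ.image fun i => X i (A i)).card = Fintype.card ι :=
      Finset.card_image_of_injective _ fun i i' h => hX _ _ _ _ h
    refine ⟨A, ?_⟩
    rw [Finset.eq_of_subset_of_card_le hsub (hcard ▸ hdist), Assignment.flip_filter_ne]
    exact hβ
  · rintro ⟨A, hA⟩
    exact ⟨_, hA, (Assignment.hammingDist_flip _ _).trans_le Finset.card_image_le⟩

end Flip

/-! ### The reduction to a CSP formula -/

/-- A literal in the data of a program, whose type must not depend on the number of variables. -/
abbrev RawLiteral : Type := ℕ × Bool

/-- A constraint in the data of a program: the list of the literals `x ≠ v` of a disjunction. -/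
abbrev RawConstraint (k : ℕ) : Type := List (ℕ × Fin k)

/-- An instance in the data of a program: the number of variables, the radius, the assignment and
the clauses. -/
abbrev RawInstance : Type := ℕ × ℕ × List Bool × List (List RawLiteral)

/-- The clauses of `L` that are false under `α`. -/
def negClauses (α : List Bool) (L : List (List RawLiteral)) : List (List RawLiteral) :=
  L.filter fun C => C.all fun l => !(α.getD l.1 false == l.2)

/-- The positions `(i, j)` at which `x` is the `j`-th variable of the `i`-th clause of `N`. -/
def positions (k : ℕ) (N : List (List RawLiteral)) (x : ℕ) : List (ℕ × Fin k) :=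
  ((List.range N.length).flatMap fun i => (List.finRange k).map fun j => (i, j)).filter fun p =>
    ((N.getD p.1 []).getD p.2 (0, false)).1 == x

/-- The constraints which say that the literal `l` is true after the variable at the position
`(i, A i)` has been flipped for each clause `i` of `N`. They are correct if each variable has at
most one position. -/
def litConstraints (k : ℕ) (α : List Bool) (N : List (List RawLiteral)) (l : RawLiteral) :
    List (RawConstraint k) :=
  bif α.getD l.1 false == l.2 then (positions k N l.1).map fun p => [p]
  else bif (positions k N l.1).isEmpty then [[]]
  else (positions k N l.1).flatMap fun p =>
    ((List.finRange k).filter fun v => !(v == p.2)).map fun v => [(p.1, v)]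

/-- The disjunction of two conjunctions of constraints, by the distributive law. -/
def disj {k : ℕ} (X Y : List (RawConstraint k)) : List (RawConstraint k) :=
  X.flatMap fun c => Y.map fun d => c ++ d

/-- The constraints for the first `w` literals of a clause. The bound `w` keeps their number
polynomial. -/
def clauseConstraints (k : ℕ) (α : List Bool) (N : List (List RawLiteral)) :
    ℕ → List RawLiteral → List (RawConstraint k)
  | 0, _ => [[]]
  | w + 1, C => disj (bif C.isEmpty then [[]] else litConstraints k α N (C.headD (0, false)))
      (clauseConstraints k α N w C.tail)

/-- The reduction of Ball-`k`-SAT to a CSP formula, given by its number of variables and its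
constraints. -/
def reduction (k : ℕ) (I : RawInstance) : ℕ × List (RawConstraint k) :=
  (I.2.1, I.2.2.2.flatMap (clauseConstraints k I.2.2.1 (negClauses I.2.2.1 I.2.2.2) k))

namespace PolyTime

variable {A : Type} [Enc A] {α : A → List Bool} {L N : A → List (List RawLiteral)}

@[fun_prop]
theorem negClauses (hα : PolyTime α) (hL : PolyTime L) :
    PolyTime fun a => negClauses (α a) (L a) := by
  unfold BallSat.negClauses
  fun_prop

@[fun_prop]
theorem positions (k : ℕ) {x : A → ℕ} (hN : PolyTime N) (hx : PolyTime x) :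
    PolyTime fun a => positions k (N a) (x a) := by
  unfold BallSat.positions
  fun_prop

@[fun_prop]
theorem litConstraints (k : ℕ) {l : A → RawLiteral} (hα : PolyTime α) (hN : PolyTime N)
    (hl : PolyTime l) : PolyTime fun a => litConstraints k (α a) (N a) (l a) := by
  unfold BallSat.litConstraints
  fun_prop

@[fun_prop]
theorem disj {k : ℕ} {X Y : A → List (RawConstraint k)} (hX : PolyTime X) (hY : PolyTime Y) :
    PolyTime fun a => disj (X a) (Y a) := by
  unfold BallSat.disj
  fun_prop

@[fun_prop]
theorem clauseConstraints (k w : ℕ) {C : A → List RawLiteral} (hα : PolyTime α) (hN : PolyTime N)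
    (hC : PolyTime C) : PolyTime fun a => clauseConstraints k (α a) (N a) w (C a) := by
  induction w generalizing C with
  | zero => exact const _
  | succ w ih =>
    have ih := ih hC.tail
    unfold BallSat.clauseConstraints
    fun_prop

theorem reduction (k : ℕ) : PolyTime (reduction k) := by
  unfold BallSat.reduction
  fun_prop

end PolyTime

/-- The values `A` satisfy the constraints `X`. -/
def SatisfiesAll {k : ℕ} (A : ℕ → Fin k) (X : List (RawConstraint k)) : Prop :=
  ∀ c ∈ X, ∃ p ∈ c, A p.1 ≠ p.2

section Constraints

variable {k r w : ℕ}

theorem satisfiesAll_disj (A : ℕ → Fin k) (X Y : List (RawConstraint k)) :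
    SatisfiesAll A (disj X Y) ↔ SatisfiesAll A X ∨ SatisfiesAll A Y := by
  simp only [SatisfiesAll, disj, List.mem_flatMap, List.mem_map]
  constructor
  · intro h
    by_contra! hXY
    obtain ⟨⟨c, hc, hAc⟩, d, hd, hAd⟩ := hXY
    obtain ⟨p, hp, hAp⟩ := h (c ++ d) ⟨c, hc, d, hd, rfl⟩
    exact (List.mem_append.1 hp).elim (fun hp => hAp (hAc p hp)) fun hp => hAp (hAd p hp)
  · rintro (h | h) _ ⟨c, hc, d, hd, rfl⟩
    · exact (h c hc).imp fun p hp => ⟨List.mem_append_left d hp.1, hp.2⟩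
    · exact (h d hd).imp fun p hp => ⟨List.mem_append_right c hp.1, hp.2⟩

theorem satisfiesAll_litConstraints (A : ℕ → Fin k) {α : List Bool}
    {N : List (List RawLiteral)} {l : RawLiteral}
    (hl : ∀ p ∈ positions k N l.1, ∀ q ∈ positions k N l.1, p = q) :
    SatisfiesAll A (litConstraints k α N l) ↔
      (α.getD l.1 false = l.2 ↔ ¬ ∃ p ∈ positions k N l.1, A p.1 = p.2) := by
  rw [litConstraints]
  cases hα : α.getD l.1 false == l.2 <;> simp only [beq_eq_false_iff_ne, beq_iff_eq] at hα
  · rcases hN : positions k N l.1 with _ | ⟨p, P⟩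
    · simpa [SatisfiesAll] using hα
    · have hP : ∀ q ∈ p :: P, q = p := fun q hq => hl q (hN ▸ hq) p (by simp [hN])
      have hselect : (∃ q ∈ p :: P, A q.1 = q.2) ↔ A p.1 = p.2 :=
        ⟨fun ⟨q, hq, hA⟩ => hP q hq ▸ hA, fun hA => ⟨p, List.mem_cons_self, hA⟩⟩
      rw [hselect]
      simp only [hα, List.isEmpty_cons, cond_false, false_iff, not_not, SatisfiesAll,
        List.mem_flatMap, List.mem_map, List.mem_filter]
      constructor
      · intro h
        by_contra hA
        obtain ⟨q, hq, hAq⟩ := h [(p.1, A p.1)]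
          ⟨p, List.mem_cons_self, A p.1, ⟨List.mem_finRange _, by simpa using hA⟩, rfl⟩
        rw [List.mem_singleton.1 hq] at hAq
        exact hAq rfl
      · rintro hA c ⟨q, hq, v, ⟨-, hv⟩, rfl⟩
        rw [hP q hq] at hv ⊢
        have hv : v ≠ p.2 := by simpa using hv
        exact ⟨_, List.mem_singleton_self _, hA.trans_ne hv.symm⟩
  · simp only [hα, cond_true, true_iff, SatisfiesAll, List.mem_map]
    constructor
    · rintro h ⟨p, hp, hA⟩
      obtain ⟨q, hq, hAq⟩ := h [p] ⟨p, hp, rfl⟩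
      exact hAq (List.mem_singleton.1 hq ▸ hA)
    · rintro h _ ⟨p, hp, rfl⟩
      exact ⟨p, List.mem_singleton_self p, fun hA => h ⟨p, hp, hA⟩⟩

theorem satisfiesAll_clauseConstraints (A : ℕ → Fin k) (α : List Bool) (N : List (List RawLiteral))
    {C : List RawLiteral} (hC : C.length ≤ w) :
    SatisfiesAll A (clauseConstraints k α N w C) ↔
      ∃ l ∈ C, SatisfiesAll A (litConstraints k α N l) := by
  have hempty : ¬ SatisfiesAll A [([] : RawConstraint k)] := by simp [SatisfiesAll]
  induction w generalizing C with
  | zero => simp [List.length_eq_zero_iff.1 (Nat.le_zero.1 hC), clauseConstraints, hempty]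
  | succ w ih =>
    rw [clauseConstraints, satisfiesAll_disj]
    cases C with
    | nil => simp [hempty, ih]
    | cons l C => simp [ih (Nat.le_of_succ_le_succ hC)]

/-- The constraint has at most `w` literals, and its variables are below `r`. -/
def Valid (w r : ℕ) (c : RawConstraint k) : Prop := c.length ≤ w ∧ ∀ p ∈ c, p.1 < r

theorem valid_disj {w' : ℕ} {X Y : List (RawConstraint k)} (hX : ∀ c ∈ X, Valid w r c)
    (hY : ∀ c ∈ Y, Valid w' r c) : ∀ c ∈ disj X Y, Valid (w + w') r c := by
  simp only [disj, List.mem_flatMap, List.mem_map]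
  rintro _ ⟨c, hc, d, hd, rfl⟩
  obtain ⟨hcw, hcr⟩ := hX c hc
  obtain ⟨hdw, hdr⟩ := hY d hd
  exact ⟨by simp only [List.length_append]; omega,
    fun p hp => (List.mem_append.1 hp).elim (hcr p) (hdr p)⟩

theorem mem_positions {N : List (List RawLiteral)} {x i : ℕ} {j : Fin k} :
    (i, j) ∈ positions k N x ↔ i < N.length ∧ ((N.getD i []).getD j (0, false)).1 = x := by
  simp [positions]

theorem valid_litConstraints (α : List Bool) (N : List (List RawLiteral)) (l : RawLiteral) :
    ∀ c ∈ litConstraints k α N l, Valid 1 N.length c := by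
  have hpos : ∀ p ∈ positions k N l.1, p.1 < N.length := fun p hp => (mem_positions.1 hp).1
  rw [litConstraints]
  cases α.getD l.1 false == l.2
  · cases (positions k N l.1).isEmpty
    · simp only [cond_false, List.mem_flatMap, List.mem_map]
      rintro _ ⟨p, hp, v, -, rfl⟩
      simpa [Valid] using hpos p hp
    · simp [Valid]
  · simp only [cond_true, List.mem_map]
    rintro _ ⟨p, hp, rfl⟩
    simpa [Valid] using hpos p hp

theorem valid_clauseConstraints (α : List Bool) (N : List (List RawLiteral)) (w : ℕ)
    (C : List RawLiteral) : ∀ c ∈ clauseConstraints k α N w C, Valid w N.length c := by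
  induction w generalizing C with
  | zero => simp [clauseConstraints, Valid]
  | succ w ih =>
    rw [clauseConstraints, add_comm]
    refine valid_disj ?_ (ih C.tail)
    cases C with
    | nil => simp [Valid]
    | cons l C => exact valid_litConstraints α N l

end Constraints

/-! ### Instances -/

/-- `Neg(F)` consists of exactly `r` pairwise disjoint `k`-clauses. -/
def Formula.NegDisjointOfCard {n : ℕ} (k : ℕ) (α : Assignment n) (F : Formula n) (r : ℕ) : Prop :=
  (F.neg α).card = r ∧ (∀ C ∈ F.neg α, C.card = k) ∧
    ∀ C ∈ F.neg α, ∀ D ∈ F.neg α, C ≠ D → Disjoint C.vbl D.vbl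

/-- The instances of Ball-`k`-SAT to which the reduction applies, with the formula written down as
the list `L`. -/
structure Instance (k : ℕ) where
  n : ℕ
  F : Formula n
  α : Assignment n
  r : ℕ
  isCNF : F.IsCNF k
  negDisjoint : F.NegDisjointOfCard k α r
  L : List (List (Literal n))
  listsOnce : ListsOnce L F

/-- A literal in the data of a program. -/
def Literal.raw {n : ℕ} (l : Literal n) : RawLiteral := (l.1, l.2)

theorem Formula.mem_neg {n : ℕ} {α : Assignment n} {F : Formula n} {C : Clause n} :
    C ∈ F.neg α ↔ C ∈ F ∧ ∀ l ∈ C, ¬ Literal.Holds α l := by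
  simp [Formula.neg]

theorem Formula.eq_of_mem_neg {n : ℕ} {α : Assignment n} {F : Formula n} {C : Clause n}
    (hC : C ∈ F.neg α) {l l' : Literal n} (hl : l ∈ C) (hl' : l' ∈ C) (h : l.1 = l'.1) :
    l = l' := by
  have hfalse := (mem_neg.1 hC).2
  have hlα := Bool.eq_not.2 (Ne.symm (hfalse l hl))
  have hl'α := Bool.eq_not.2 (Ne.symm (hfalse l' hl'))
  exact Prod.ext h (by rw [hlα, hl'α, h])

theorem encList_map {β γ : Type} (e : γ → Data) (g : β → γ) (l : List β) :
    encList e (l.map g) = encList (fun b => e (g b)) l := by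
  induction l with
  | nil => rfl
  | cons b l ih => simp [encList, ih]

namespace Instance

variable {k : ℕ} (I : Instance k)

/-- An instance in the data of a program. -/
def raw : RawInstance := (I.n, I.r, List.ofFn I.α, I.L.map (List.map Literal.raw))

theorem enc_raw : enc I.raw = encInstance I.n I.L I.α I.r := by
  change Data.cons _ (.cons _ (.cons _
    (encList (encList enc) (I.L.map (List.map Literal.raw))))) = _
  simp only [encList_map]
  rfl

theorem mem_L {C : Clause I.n} : C ∈ I.F ↔ ∃ D ∈ I.L, D.toFinset = C := by
  rw [← I.listsOnce.1, List.mem_toFinset, List.mem_map]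

theorem length_le_of_mem {C : List (Literal I.n)} (hC : C ∈ I.L) : C.length ≤ k := by
  rw [← List.toFinset_card_of_nodup (I.listsOnce.2.2 C hC)]
  exact I.isCNF _ (I.mem_L.2 ⟨C, hC, rfl⟩)

/-- The list of the false clauses. -/
def falseClauses : List (List (Literal I.n)) :=
  I.L.filter fun C => C.all fun l => !(I.α l.1 == l.2)

theorem negClauses_raw :
    negClauses (List.ofFn I.α) (I.L.map (List.map Literal.raw)) =
      I.falseClauses.map (List.map Literal.raw) := by
  rw [negClauses, List.filter_map, falseClauses]
  simp [Function.comp_def, Literal.raw]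

theorem mem_falseClauses {C : List (Literal I.n)} :
    C ∈ I.falseClauses ↔ C ∈ I.L ∧ C.toFinset ∈ I.F.neg I.α := by
  rw [falseClauses, List.mem_filter, Formula.mem_neg]
  refine and_congr_right fun hC => ?_
  simp only [I.mem_L.2 ⟨C, hC, rfl⟩, List.all_eq_true, true_and, List.mem_toFinset]
  simp [Literal.Holds]

theorem nodup_falseClauses : (I.falseClauses.map List.toFinset).Nodup :=
  I.listsOnce.2.1.sublist (List.filter_sublist.map _)

theorem length_falseClauses : I.falseClauses.length = I.r := by
  rw [← I.negDisjoint.1, ← List.length_map (f := List.toFinset),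
    ← List.toFinset_card_of_nodup I.nodup_falseClauses]
  congr 1
  ext C
  simp only [List.mem_toFinset, List.mem_map, mem_falseClauses]
  constructor
  · rintro ⟨D, hD, rfl⟩
    exact hD.2
  · intro hC
    obtain ⟨D, hD, rfl⟩ := I.mem_L.1 (Formula.mem_neg.1 hC).1
    exact ⟨D, ⟨hD, hC⟩, rfl⟩

/-- The `i`-th false clause. -/
def falseClause (i : Fin I.r) : List (Literal I.n) :=
  I.falseClauses[i]'(i.2.trans_eq I.length_falseClauses.symm)

theorem falseClause_mem (i : Fin I.r) : I.falseClause i ∈ I.falseClauses := List.getElem_mem _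

theorem length_falseClause (i : Fin I.r) : (I.falseClause i).length = k := by
  have h := I.mem_falseClauses.1 (I.falseClause_mem i)
  rw [← List.toFinset_card_of_nodup (I.listsOnce.2.2 _ h.1), I.negDisjoint.2.1 _ h.2]

theorem falseClause_injective {i i' : Fin I.r}
    (h : (I.falseClause i).toFinset = (I.falseClause i').toFinset) : i = i' := by
  refine Fin.ext ((I.nodup_falseClauses.getElem_inj_iff (hi := ?_) (hj := ?_)).1 ?_)
  · simp [length_falseClauses]
  · simp [length_falseClauses]
  · simpa [falseClause] using h

/-- The `j`-th literal of the `i`-th false clause. -/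
def falseLiteral (i : Fin I.r) (j : Fin k) : Literal I.n :=
  (I.falseClause i)[j]'(j.2.trans_eq (I.length_falseClause i).symm)

theorem falseLiteral_mem (i : Fin I.r) (j : Fin k) : I.falseLiteral i j ∈ I.falseClause i :=
  List.getElem_mem _

theorem falseLiteral_fst_injective {i i' : Fin I.r} {j j' : Fin k}
    (h : (I.falseLiteral i j).1 = (I.falseLiteral i' j').1) : i = i' ∧ j = j' := by
  have hmem := List.mem_toFinset.2 (I.falseLiteral_mem i j)
  have hmem' := List.mem_toFinset.2 (I.falseLiteral_mem i' j')
  have hneg (i) := I.mem_falseClauses.1 (I.falseClause_mem i)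
  obtain rfl : i = i' := by
    by_contra hne
    refine Finset.disjoint_left.1 (I.negDisjoint.2.2 _ (hneg i).2 _ (hneg i').2
      fun heq => hne (I.falseClause_injective heq)) (Finset.mem_image_of_mem _ hmem) ?_
    rw [h]
    exact Finset.mem_image_of_mem _ hmem'
  have hll' := Formula.eq_of_mem_neg (hneg i).2 hmem hmem' h
  exact ⟨rfl, Fin.ext ((I.listsOnce.2.2 _ (hneg i).1).getElem_inj_iff.1 hll')⟩

theorem exists_falseLiteral_eq {i : Fin I.r} {l : Literal I.n} (hl : l ∈ I.falseClause i) :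
    ∃ j, I.falseLiteral i j = l := by
  obtain ⟨j, hj, rfl⟩ := List.mem_iff_getElem.1 hl
  exact ⟨⟨j, hj.trans_eq (I.length_falseClause i)⟩, rfl⟩

theorem mem_positions_raw {x : Fin I.n} {i : ℕ} {j : Fin k} :
    (i, j) ∈ positions k (I.falseClauses.map (List.map Literal.raw)) x ↔
      ∃ h : i < I.r, (I.falseLiteral ⟨i, h⟩ j).1 = x := by
  rw [mem_positions, List.length_map, I.length_falseClauses, ← exists_prop]
  refine exists_congr fun h => ?_
  have hi : i < I.falseClauses.length := h.trans_eq I.length_falseClauses.symm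
  have hj : j < I.falseClauses[i].length := j.2.trans_eq (I.length_falseClause ⟨i, h⟩).symm
  simp [hi, hj, falseLiteral, falseClause, Literal.raw, Fin.ext_iff]

theorem holds_iff (β : Assignment I.n) :
    I.F.Holds β ↔ ∀ C ∈ I.L, ∃ l ∈ C, Literal.Holds β l := by
  rw [← I.listsOnce.1]
  simp [Formula.Holds, Clause.Holds]

theorem satisfiesAll_reduction_iff (A : ℕ → Fin k) :
    SatisfiesAll A (reduction k I.raw).2 ↔
      I.F.Holds (I.α.flip (Finset.univ.image fun i => (I.falseLiteral i (A i)).1)) := by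
  set N := I.falseClauses.map (List.map Literal.raw) with hN
  have hunique (x : Fin I.n) : ∀ p ∈ positions k N x, ∀ q ∈ positions k N x, p = q := by
    rintro ⟨i, j⟩ hp ⟨i', j'⟩ hq
    obtain ⟨hi, hp⟩ := I.mem_positions_raw.1 hp
    obtain ⟨hi', hq⟩ := I.mem_positions_raw.1 hq
    simpa using I.falseLiteral_fst_injective (hp.trans hq.symm)
  have hselect (x : Fin I.n) : (∃ p ∈ positions k N x, A p.1 = p.2) ↔
      x ∈ Finset.univ.image fun i => (I.falseLiteral i (A i)).1 := by
    simp [N, I.mem_positions_raw, Fin.exists_iff]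
  have hlit (l : Literal I.n) : SatisfiesAll A (litConstraints k (List.ofFn I.α) N l.raw) ↔
      Literal.Holds (I.α.flip (Finset.univ.image fun i => (I.falseLiteral i (A i)).1)) l := by
    rw [satisfiesAll_litConstraints A (hunique l.1), Literal.raw, hselect, Literal.holds_flip]
    simp [Literal.Holds]
  have hclause : ∀ C ∈ I.L, SatisfiesAll A
      (clauseConstraints k (List.ofFn I.α) N k (C.map Literal.raw)) ↔
        ∃ l ∈ C, SatisfiesAll A (litConstraints k (List.ofFn I.α) N l.raw) := fun C hC => by
    rw [satisfiesAll_clauseConstraints _ _ _ (by simpa using I.length_le_of_mem hC)]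
    simp only [List.mem_map, exists_exists_and_eq_and]
  rw [holds_iff, ← forall₂_congr fun C hC => (hclause C hC).trans (exists_congr fun l =>
    and_congr_right fun _ => hlit l), hN, ← negClauses_raw]
  simp only [SatisfiesAll, reduction, raw, List.flatMap_map, List.mem_flatMap,
    forall_exists_index, and_imp]
  exact ⟨fun h C hC c hc => h c C hC hc, fun h c C hC hc => h C hC c hc⟩

theorem satisfiable_reduction_iff [NeZero k] :
    (∃ A, SatisfiesAll A (reduction k I.raw).2) ↔ InBall I.F I.α I.r := by
  have hinj (i i' : Fin I.r) (j j' : Fin k)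
      (h : (I.falseLiteral i j).1 = (I.falseLiteral i' j').1) : i = i' :=
    (I.falseLiteral_fst_injective h).1
  have hfalse (i : Fin I.r) : ∃ C ∈ I.F, ∀ l ∈ C,
      (∃ j, (I.falseLiteral i j).1 = l.1) ∧ ¬ Literal.Holds I.α l := by
    have hneg := Formula.mem_neg.1 (I.mem_falseClauses.1 (I.falseClause_mem i)).2
    refine ⟨_, hneg.1, fun l hl => ⟨?_, hneg.2 l hl⟩⟩
    obtain ⟨j, rfl⟩ := I.exists_falseLiteral_eq (List.mem_toFinset.1 hl)
    exact ⟨j, rfl⟩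
  have hball := inBall_iff_exists_holds_flip hinj hfalse
  have hextend : Function.Surjective fun (A : ℕ → Fin k) (i : Fin I.r) => A i :=
    Fin.val_injective.surjective_comp_right
  rw [Fintype.card_fin] at hball
  simp only [hball, hextend.exists, satisfiesAll_reduction_iff]

theorem valid_reduction : ∀ c ∈ (reduction k I.raw).2, Valid k I.r c := by
  intro c hc
  obtain ⟨C, -, hc⟩ := List.mem_flatMap.1 hc
  have hlength : (negClauses (List.ofFn I.α) (I.L.map (List.map Literal.raw))).length = I.r := by
    rw [negClauses_raw, List.length_map, length_falseClauses]
  exact hlength ▸ valid_clauseConstraints _ _ _ _ c hc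

end Instance

/-! ### Covering codes -/

section Translates

variable {Γ : Type*} [AddCommGroup Γ] [Fintype Γ]

theorem exists_card_mul_card_div_le_card_filter_sub_mem [DecidableEq Γ] (S U : Finset Γ) :
    ∃ c : Γ, (U.card * S.card / Fintype.card Γ : ℝ) ≤ (U.filter fun x => x - c ∈ S).card := by
  have hsum : ∑ c : Γ, (U.filter fun x => x - c ∈ S).card = U.card * S.card := by
    have h (x : Γ) : (Finset.univ.filter fun c : Γ => x - c ∈ S).card = S.card :=
      Finset.card_bij' (fun c _ => x - c) (fun y _ => x - y) (by simp) (by simp) (by simp)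
        (by simp)
    have hswap := Finset.sum_card_bipartiteAbove_eq_sum_card_bipartiteBelow (s := U)
      (t := Finset.univ) fun x c => x - c ∈ S
    simp only [Finset.bipartiteAbove, Finset.bipartiteBelow, h, Finset.sum_const,
      smul_eq_mul] at hswap
    exact hswap.symm
  obtain ⟨c, -, hc⟩ := Finset.exists_le_of_sum_le (s := (Finset.univ : Finset Γ))
    (f := fun _ => (U.card * S.card / Fintype.card Γ : ℝ))
    (g := fun c => ((U.filter fun x => x - c ∈ S).card : ℝ)) Finset.univ_nonempty (by
      rw [← Nat.cast_sum, hsum, Finset.sum_const, Finset.card_univ, nsmul_eq_mul, Nat.cast_mul]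
      exact (mul_div_cancel₀ _ (by simp)).le)
  exact ⟨c, hc⟩

theorem exists_card_not_covered_le [DecidableEq Γ] (S : Finset Γ) (N : ℕ) :
    ∃ l : List Γ, l.length = N ∧
      ((Finset.univ.filter fun x : Γ => ∀ c ∈ l, x - c ∉ S).card : ℝ) ≤
        Fintype.card Γ * (1 - S.card / Fintype.card Γ) ^ N := by
  induction N with
  | zero => exact ⟨[], rfl, by simp⟩
  | succ N ih =>
    obtain ⟨l, hl, hU⟩ := ih
    set U := Finset.univ.filter fun x : Γ => ∀ c ∈ l, x - c ∉ S
    obtain ⟨c, hc⟩ := exists_card_mul_card_div_le_card_filter_sub_mem S U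
    refine ⟨c :: l, by simp [hl], ?_⟩
    have hdensity : (0 : ℝ) ≤ 1 - S.card / Fintype.card Γ := by
      rw [sub_nonneg, div_le_one (by exact_mod_cast Fintype.card_pos)]
      exact_mod_cast Finset.card_le_univ S
    have hcard : ((Finset.univ.filter fun x : Γ => ∀ d ∈ c :: l, x - d ∉ S).card : ℝ) =
        U.card - (U.filter fun x => x - c ∈ S).card := by
      rw [eq_sub_iff_add_eq, ← Finset.card_filter_add_card_filter_not (s := U)
        (fun x => x - c ∈ S), Nat.cast_add, add_comm]
      congr 3
      ext x
      simp [U, and_comm]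
    calc ((Finset.univ.filter fun x : Γ => ∀ d ∈ c :: l, x - d ∉ S).card : ℝ)
        ≤ U.card - U.card * S.card / Fintype.card Γ := by linarith
      _ = U.card * (1 - S.card / Fintype.card Γ) := by ring
      _ ≤ Fintype.card Γ * (1 - S.card / Fintype.card Γ) ^ N * (1 - S.card / Fintype.card Γ) := by
        gcongr
      _ = _ := by rw [pow_succ, mul_assoc]

theorem exists_covering_translates {S : Finset Γ} (hS : S.Nonempty) :
    ∃ l : List Γ, (∀ x, ∃ c ∈ l, x - c ∈ S) ∧
      (l.length : ℝ) ≤ Fintype.card Γ / S.card * Real.log (Fintype.card Γ) + 1 := by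
  classical
  have hS0 : (0 : ℝ) < S.card := by exact_mod_cast hS.card_pos
  have hΓ0 : (0 : ℝ) < Fintype.card Γ := by exact_mod_cast Fintype.card_pos
  set q : ℝ := Fintype.card Γ / S.card with hq
  have hlog : 0 ≤ q * Real.log (Fintype.card Γ) := by positivity
  obtain ⟨l, hl, hU⟩ := exists_card_not_covered_le S (⌊q * Real.log (Fintype.card Γ)⌋₊ + 1)
  refine ⟨l, fun x => ?_, ?_⟩
  · have hlt : Fintype.card Γ * (1 - S.card / Fintype.card Γ : ℝ) ^ l.length < 1 := by
      have hexp : (1 - S.card / Fintype.card Γ : ℝ) ≤ Real.exp (-(1 / q)) := by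
        rw [hq, one_div_div]
        exact Real.one_sub_le_exp_neg _
      have hdensity : (0 : ℝ) ≤ 1 - S.card / Fintype.card Γ := by
        rw [sub_nonneg, div_le_one hΓ0]
        exact_mod_cast Finset.card_le_univ S
      have hlength : q * Real.log (Fintype.card Γ) < l.length := by
        rw [hl, Nat.cast_add_one]
        exact Nat.lt_floor_add_one _
      calc Fintype.card Γ * (1 - S.card / Fintype.card Γ : ℝ) ^ l.length
          ≤ Real.exp (Real.log (Fintype.card Γ)) * Real.exp (-(1 / q)) ^ l.length := by
            rw [Real.exp_log hΓ0]
            gcongr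
        _ = Real.exp (Real.log (Fintype.card Γ) - l.length / q) := by
            rw [← Real.exp_nat_mul, ← Real.exp_add]
            ring_nf
        _ < 1 := by
            rw [Real.exp_lt_one_iff, sub_neg, lt_div_iff₀' (div_pos hΓ0 hS0)]
            exact hlength
    rw [← hl] at hU
    have hempty := Finset.card_eq_zero.1 (Nat.lt_one_iff.1 (by exact_mod_cast hU.trans_lt hlt))
    by_contra! hx
    exact Finset.notMem_empty x (hempty ▸ by simpa using hx)
  · rw [hl, Nat.cast_add_one]
    gcongr
    exact Nat.floor_le hlog

end Translates

section Code

variable {k b : ℕ}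

/-- The directed distance of `x` from the origin. -/
def weight (x : Fin b → Fin k) : ℕ := ∑ i, (x i : ℕ)

theorem weight_le (x : Fin b → Fin k) : weight x ≤ k * b := by
  refine (Finset.sum_le_card_nsmul _ _ k fun i _ => (x i).2.le).trans_eq ?_
  simp [mul_comm]

theorem sum_pow_weight (t : ℝ) :
    ∑ x : Fin b → Fin k, t ^ weight x = (∑ v : Fin k, t ^ (v : ℕ)) ^ b := by
  simp only [weight, ← Finset.prod_pow_eq_pow_sum]
  rw [← Fintype.piFinset_univ, Finset.sum_prod_piFinset _ fun _ (v : Fin k) => t ^ (v : ℕ)]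
  simp

theorem exists_sum_pow_pow_le_card_sphere (k b : ℕ) (t : ℝ) : ∃ s ≤ k * b,
    (∑ v : Fin k, t ^ (v : ℕ)) ^ b ≤
      (k * b + 1) * ((Finset.univ.filter fun x : Fin b → Fin k => weight x = s).card * t ^ s) := by
  have hsum : ∑ s ∈ Finset.range (k * b + 1),
      (Finset.univ.filter fun x : Fin b → Fin k => weight x = s).card * t ^ s =
        (∑ v : Fin k, t ^ (v : ℕ)) ^ b := by
    rw [← sum_pow_weight, ← Finset.sum_fiberwise_of_maps_to (t := Finset.range (k * b + 1))
      (g := weight) fun x _ => Finset.mem_range_succ_iff.2 (weight_le x)]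
    refine Finset.sum_congr rfl fun s _ => ?_
    rw [Finset.sum_congr rfl fun x hx => congrArg (t ^ ·) (Finset.mem_filter.1 hx).2,
      Finset.sum_const, nsmul_eq_mul]
  obtain ⟨s, hs, h⟩ := Finset.exists_le_of_sum_le (s := Finset.range (k * b + 1))
    (f := fun _ => (∑ v : Fin k, t ^ (v : ℕ)) ^ b / (k * b + 1)) (g := fun s =>
      (Finset.univ.filter fun x : Fin b → Fin k => weight x = s).card * t ^ s)
    (by simp) (by
      rw [hsum, Finset.sum_const, Finset.card_range, nsmul_eq_mul]
      push_cast
      exact (mul_div_cancel₀ _ (by positivity)).le)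
  exact ⟨s, Finset.mem_range_succ_iff.1 hs, (div_le_iff₀' (by positivity)).1 h⟩

theorem exists_code (k b : ℕ) [NeZero k] : ∃ (s : ℕ) (l : List (Fin b → Fin k)), s ≤ k * b ∧
    (∀ x, ∃ c ∈ l, weight (x - c) = s) ∧
    (l.length * k ^ s : ℝ) ≤ (k / ∑ v : Fin k, (k : ℝ)⁻¹ ^ (v : ℕ)) ^ b * (k * b + 1) ^ 2 := by
  obtain ⟨s, hs, hsphere⟩ := exists_sum_pow_pow_le_card_sphere k b (k : ℝ)⁻¹
  set S := Finset.univ.filter fun x : Fin b → Fin k => weight x = s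
  set σ := ∑ v : Fin k, (k : ℝ)⁻¹ ^ (v : ℕ)
  have hk : (0 : ℝ) < k := by exact_mod_cast NeZero.pos k
  have hσ0 : 0 < σ := Finset.sum_pos (fun v _ => by positivity) Finset.univ_nonempty
  have hS : S.Nonempty := by
    by_contra h
    rw [Finset.not_nonempty_iff_eq_empty.1 h] at hsphere
    simp only [Finset.card_empty, Nat.cast_zero, zero_mul, mul_zero] at hsphere
    exact (pow_pos hσ0 b).not_ge hsphere
  obtain ⟨l, hl, hlength⟩ := exists_covering_translates hS
  refine ⟨s, l, hs, by simpa [S] using hl, ?_⟩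
  have hS0 : (0 : ℝ) < S.card := by exact_mod_cast hS.card_pos
  have hcard : (Fintype.card (Fin b → Fin k) : ℝ) = k ^ b := by simp
  have hlog : Real.log (k ^ b) ≤ k * b := by
    rw [Real.log_pow, mul_comm]
    gcongr
    exact Real.log_le_self hk.le
  have hone : 1 ≤ (k : ℝ) ^ b / S.card := by
    rw [one_le_div hS0, ← hcard]
    exact_mod_cast Finset.card_le_univ S
  have hradius : (k : ℝ) ^ s / S.card ≤ (k * b + 1) / σ ^ b := by
    rw [inv_pow] at hsphere
    field_simp at hsphere ⊢
    linarith
  rw [hcard] at hlength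
  calc (l.length * k ^ s : ℝ) ≤ (k ^ b / S.card * (k * b) + k ^ b / S.card) * k ^ s := by
        gcongr
        exact hlength.trans (by gcongr)
    _ = k ^ b * (k ^ s / S.card) * (k * b + 1) := by ring
    _ ≤ k ^ b * ((k * b + 1) / σ ^ b) * (k * b + 1) := by gcongr
    _ = _ := by rw [div_pow]; ring

theorem exists_pow_mul_sq_le_pow (k : ℕ) {ρ c : ℝ} (hρ : 0 ≤ ρ) (hρc : ρ < c) :
    ∃ b : ℕ, 0 < b ∧ ρ ^ b * (k * b + 1) ^ 2 ≤ c ^ b := by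
  have hlittle := isLittleO_pow_const_mul_const_pow_const_pow_of_norm_lt 2
    (show ‖ρ‖ < c by rwa [Real.norm_of_nonneg hρ])
  obtain ⟨b, hb, hb0⟩ := ((hlittle.bound (show (0 : ℝ) < ((k + 1 : ℝ) ^ 2)⁻¹ by positivity)).and
    (Filter.eventually_ge_atTop 1)).exists
  have hb1 : (1 : ℝ) ≤ b := by exact_mod_cast hb0
  rw [Real.norm_of_nonneg (by positivity), Real.norm_of_nonneg (pow_nonneg (hρ.trans hρc.le) b),
    inv_mul_eq_div, le_div_iff₀' (by positivity)] at hb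
  refine ⟨b, hb0, le_trans ?_ hb⟩
  calc ρ ^ b * (k * b + 1) ^ 2 ≤ ρ ^ b * (k * b + b) ^ 2 := by gcongr
    _ = _ := by ring

/-- The directed distance to `x` from the values `a` of the variables `m, m + 1, …`. -/
def dirDist (x : ℕ → Fin k) : ℕ → List (Fin k) → ℕ
  | _, [] => 0
  | m, v :: a => (x m - v : Fin k) + dirDist x (m + 1) a

theorem dirDist_append (x : ℕ → Fin k) (m : ℕ) (a a' : List (Fin k)) :
    dirDist x m (a ++ a') = dirDist x m a + dirDist x (m + a.length) a' := by
  induction a generalizing m with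
  | nil => simp [dirDist]
  | cons v a ih =>
    rw [List.cons_append, dirDist, dirDist, ih, List.length_cons, add_right_comm m]
    ac_rfl

theorem dirDist_ofFn (x : ℕ → Fin k) (m : ℕ) (c : Fin b → Fin k) :
    dirDist x m (List.ofFn c) = weight ((fun i : Fin b => x (m + i)) - c) := by
  induction b generalizing m with
  | zero => simp [dirDist, weight]
  | succ b ih =>
    rw [List.ofFn_succ, dirDist, ih, weight, weight, Fin.sum_univ_succ]
    simp [add_assoc, add_comm 1]

/-- The balls of radius `s` around the words of `l` cover all words of length `b`. -/
structure IsCoveringCode (b s : ℕ) (l : List (List (Fin k))) : Prop where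
  length_eq : ∀ c ∈ l, c.length = b
  radius_le : s ≤ k * b
  covers : ∀ x m, ∃ c ∈ l, dirDist x m c ≤ s

theorem isCoveringCode_finRange [NeZero k] :
    IsCoveringCode 1 0 ((List.finRange k).map fun v => [v]) where
  length_eq := by simp
  radius_le := Nat.zero_le _
  covers x m := ⟨[x m], by simp, by simp [dirDist]⟩

theorem exists_isCoveringCode [NeZero k] {c : ℝ}
    (hc : k / ∑ v : Fin k, (k : ℝ)⁻¹ ^ (v : ℕ) < c) :
    ∃ (b s : ℕ) (l : List (List (Fin k))), 0 < b ∧ IsCoveringCode b s l ∧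
      (l.length * k ^ s : ℝ) ≤ c ^ b := by
  obtain ⟨b, hb, hbc⟩ := exists_pow_mul_sq_le_pow k (by positivity) hc
  obtain ⟨s, l, hs, hl, hlength⟩ := exists_code k b
  refine ⟨b, s, l.map List.ofFn, hb, ⟨by simp, hs, fun x m => ?_⟩, ?_⟩
  · obtain ⟨w, hw, hdist⟩ := hl fun i => x (m + i)
    exact ⟨_, List.mem_map_of_mem hw, ((dirDist_ofFn x m w).trans hdist).le⟩
  · rw [List.length_map]
    exact hlength.trans hbc

end Code

/-! ### Depth-first search -/

/-- An accepting node can be reached from `s`, where `ch` lists the children of a node. -/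
def Reaches {S : Type*} (acc : S → Bool) (ch : S → List S) (s : S) : Prop :=
  ∃ t, Relation.ReflTransGen (fun u v => v ∈ ch u) s t ∧ acc t = true

section Reaches

variable {S : Type*} {acc : S → Bool} {ch : S → List S}

theorem reaches_iff {s : S} :
    Reaches acc ch s ↔ acc s = true ∨ ∃ t ∈ ch s, Reaches acc ch t := by
  constructor
  · rintro ⟨t, hst, ht⟩
    rcases hst.cases_head with rfl | ⟨u, hu, hut⟩
    · exact .inl ht
    · exact .inr ⟨u, hu, t, hut, ht⟩
  · rintro (hs | ⟨u, hu, t, hut, ht⟩)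
    · exact ⟨s, .refl, hs⟩
    · exact ⟨t, hut.head hu, ht⟩

theorem reaches_of_forall_exists_lt {p : S → Prop} (μ : S → ℕ)
    (h : ∀ s, p s → acc s = true ∨ ∃ t ∈ ch s, p t ∧ μ t < μ s) {s : S} (hs : p s) :
    Reaches acc ch s := by
  induction hμ : μ s using Nat.strong_induction_on generalizing s with
  | _ N ih =>
    refine reaches_iff.2 ((h s hs).imp_right ?_)
    rintro ⟨t, ht, hpt, hlt⟩
    exact ⟨t, ht, ih _ (hμ ▸ hlt) hpt rfl⟩

end Reaches

/-- The body of the `k`-th function of a program, which searches the trees below a list of nodes.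
Its argument is the pair of a parameter and the list. The `i`-th function recognizes the accepting
nodes, and the `j`-th function lists the children of a node. -/
def searchBody (i j k : ℕ) : Expr :=
  .ite (.tl .arg)
    (.ite (.call i (.cons (.hd .arg) (.hd (.tl .arg)))) (.cons .nil .nil)
      (.ite (.call k (.cons (.hd .arg) (.call j (.cons (.hd .arg) (.hd (.tl .arg))))))
        (.cons .nil .nil) (.call k (.cons (.hd .arg) (.tl (.tl .arg))))))
    .nil

open Classical in
theorem evaluatesIn_searchBody {S : Type} [Enc S] {P : Program} {c : Data} {i j k M : ℕ}
    {acc : S → Bool} {ch : S → List S} {Inv : S → Prop} {W : S → ℕ}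
    (hk : P[k]? = some (searchBody i j k))
    (hacc : ∀ {x d T s}, Inv s → EvaluatesIn P x d (.cons c (enc s)) T →
      EvaluatesIn P x (.call i d) (enc (acc s)) (T + M))
    (hch : ∀ {x d T s}, Inv s → EvaluatesIn P x d (.cons c (enc s)) T →
      EvaluatesIn P x (.call j d) (enc (ch s)) (T + M))
    (hInv : ∀ s, Inv s → ∀ t ∈ ch s, Inv t) (hW : ∀ s, Inv s → ((ch s).map W).sum + 1 ≤ W s)
    {l : List S} (hl : ∀ s ∈ l, Inv s) :
    EvaluatesIn P (.cons c (enc l)) (searchBody i j k) (enc (decide (∃ s ∈ l, Reaches acc ch s)))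
      ((l.map W).sum * (2 * M + 43) + 4) := by
  induction hN : (l.map W).sum using Nat.strong_induction_on generalizing l with
  | _ N ih =>
    cases l with
    | nil =>
      have hnone : decide (∃ s ∈ ([] : List S), Reaches acc ch s) = false := by simp
      rw [hnone]
      exact (EvaluatesIn.arg.tl.ite_nil .nil).mono (by omega)
    | cons s l =>
      obtain ⟨hs, hl⟩ := List.forall_mem_cons.1 hl
      rw [List.map_cons, List.sum_cons] at hN
      have hWs := hW s hs
      have hor : decide (∃ t ∈ s :: l, Reaches acc ch t) =
          (acc s || (decide (∃ t ∈ ch s, Reaches acc ch t) ||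
            decide (∃ t ∈ l, Reaches acc ch t))) := by
        rw [Bool.eq_iff_iff]
        simp [reaches_iff (s := s), or_assoc]
      have harg : EvaluatesIn P (.cons c (enc (s :: l))) .arg
        (.cons c (.cons (enc s) (enc l))) 1 := .arg
      have hnode := harg.hd.cons harg.tl.hd
      have hbelow := (harg.hd.cons (hch hs hnode)).call hk (ih _ (by omega) (hInv s hs) rfl)
      have hrest := (harg.hd.cons harg.tl.tl).call hk (ih _ (by omega) hl rfl)
      rw [hor]
      refine (harg.tl.ite_cons ((hacc hs hnode).or (hbelow.or hrest))).mono ?_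
      have hmul : (((ch s).map W).sum + 1 + (l.map W).sum) * (2 * M + 43) ≤ N * (2 * M + 43) := by
        gcongr
        omega
      simp only [add_mul, one_mul] at hmul
      omega

open Classical in
theorem ComputableInTime.search {A C S : Type} [Enc A] [Enc C] [Enc S] {acc : C → S → Bool}
    {ch : C → S → List S} {c : A → C} {l : A → List S} {T U : C × S → ℕ} {V M : A → ℕ}
    {Inv : A → S → Prop} {W : A → S → ℕ}
    (hacc : ComputableInTime (fun p : C × S => acc p.1 p.2) T)
    (hch : ComputableInTime (fun p : C × S => ch p.1 p.2) U)
    (hcl : ComputableInTime (fun a => (c a, l a)) V) (hl : ∀ a, ∀ s ∈ l a, Inv a s)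
    (hInv : ∀ a s, Inv a s → ∀ t ∈ ch (c a) s, Inv a t)
    (hM : ∀ a s, Inv a s → T (c a, s) < M a ∧ U (c a, s) < M a)
    (hW : ∀ a s, Inv a s → ((ch (c a) s).map (W a)).sum + 1 ≤ W a s) :
    ComputableInTime (fun a => decide (∃ s ∈ l a, Reaches (acc (c a)) (ch (c a)) s))
      fun a => V a + ((l a).map (W a)).sum * (2 * M a + 43) + 5 := by
  intro n
  obtain ⟨Q, e, hcl⟩ := hcl n
  obtain ⟨Q', i, hacc⟩ := hacc.exists_call (n + Q.length)
  obtain ⟨Q'', j, hch⟩ := hch.exists_call (n + Q.length + Q'.length)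
  let k := n + Q.length + Q'.length + Q''.length
  refine ⟨Q ++ (Q' ++ (Q'' ++ [searchBody i j k])), .call k e, fun P hP a => ?_⟩
  simp only [append_prefix_drop] at hP
  obtain ⟨hQ, hQ', hQ'', hk⟩ := hP
  have hacc' {x : Data} {d : Expr} {t : ℕ} {s : S} (hs : Inv a s)
      (hd : EvaluatesIn P x d (.cons (enc (c a)) (enc s)) t) :
      EvaluatesIn P x (.call i d) (enc (acc (c a) s)) (t + M a) :=
    (hacc P hQ' (a := (c a, s)) hd).mono (by have := (hM a s hs).1; omega)
  have hch' {x : Data} {d : Expr} {t : ℕ} {s : S} (hs : Inv a s)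
      (hd : EvaluatesIn P x d (.cons (enc (c a)) (enc s)) t) :
      EvaluatesIn P x (.call j d) (enc (ch (c a) s)) (t + M a) :=
    (hch P hQ'' (a := (c a, s)) hd).mono (by have := (hM a s hs).2; omega)
  have hk := getElem?_of_singleton_prefix_drop hk
  have hsearch := evaluatesIn_searchBody hk hacc' hch' (hInv a) (hW a) (hl a)
  exact ((hcl P hQ a).call hk hsearch).mono (by dsimp only; omega)

open Classical in
theorem PolyTime.exists_computableInTime_search {A C S : Type} [Enc A] [Enc C] [Enc S]
    {acc : C → S → Bool} {ch : C → S → List S} {c : A → C} {l : A → List S} {σ : A → ℕ}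
    {Inv : A → S → Prop} {W : A → S → ℕ} (hacc : PolyTime fun p : C × S => acc p.1 p.2)
    (hch : PolyTime fun p : C × S => ch p.1 p.2) (hc : PolyTime c) (hl : PolyTime l)
    (hσ : PolyBounded (encSize (A := A)) σ) (hsize : ∀ a s, Inv a s → encSize s ≤ σ a)
    (hInvl : ∀ a, ∀ s ∈ l a, Inv a s) (hInv : ∀ a s, Inv a s → ∀ t ∈ ch (c a) s, Inv a t)
    (hW : ∀ a s, Inv a s → ((ch (c a) s).map (W a)).sum + 1 ≤ W a s) :
    ∃ V M : A → ℕ, PolyBounded (encSize (A := A)) V ∧ PolyBounded (encSize (A := A)) M ∧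
      ComputableInTime (fun a => decide (∃ s ∈ l a, Reaches (acc (c a)) (ch (c a)) s))
        fun a => V a + ((l a).map (W a)).sum * M a := by
  obtain ⟨-, T, ⟨p, hp⟩, hacc⟩ := hacc
  obtain ⟨-, U, ⟨q, hq⟩, hch⟩ := hch
  obtain ⟨-, V, hV, hcl⟩ := hc.prodMk hl
  let τ (a : A) : ℕ := encSize (c a) + σ a + 1
  have hτ : PolyBounded (encSize (A := A)) τ := (hc.1.add hσ).add (.const _ 1)
  let M (a : A) : ℕ := p.eval (τ a) + q.eval (τ a) + 1
  have hM : PolyBounded (encSize (A := A)) M := ((hτ.eval p).add (hτ.eval q)).add (.const _ 1)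
  have hTU (a : A) (s : S) (hs : Inv a s) : T (c a, s) < M a ∧ U (c a, s) < M a := by
    have hτs : encSize (c a, s) ≤ τ a := by
      have := hsize a s hs
      simp only [encSize_mk, τ]
      omega
    have hT := (hp (c a, s)).trans (eval_le_eval p hτs)
    have hU := (hq (c a, s)).trans (eval_le_eval q hτs)
    simp only [M]
    omega
  refine ⟨_, _, hV.add (.const _ 5), ((PolyBounded.const _ 2).mul hM).add (.const _ 43), ?_⟩
  exact (hacc.search hch hcl hInvl hInv hTU hW).mono fun a => by omega

/-! ### Local search -/

/-- A state `(m, e, a)` of the local search: the variables below `m` have no value yet, `a` lists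
the values of the variables `m, m + 1, …`, and `e` bounds their remaining directed distance to the
solution. -/
abbrev SearchState (k : ℕ) : Type := ℕ × ℕ × List (Fin k)

section Extensions

variable {k r b e : ℕ} {l : List (List (Fin k))} {s t : SearchState k}

/-- The branching over a code `l` of length `b` and radius `e`: its words are the possible values
of the `b` variables below `s.1`. -/
def extensions (b e : ℕ) (l : List (List (Fin k))) (s : SearchState k) : List (SearchState k) :=
  l.map fun c => (s.1 - b, s.2.1 + e, c ++ s.2.2)

@[fun_prop]
theorem PolyTime.extensions {A : Type} [Enc A] {s : A → SearchState k} (b e : ℕ)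
    (l : List (List (Fin k))) (hs : PolyTime s) : PolyTime fun x => extensions b e l (s x) := by
  unfold BallSat.extensions
  fun_prop

/-- The invariant of the local search for the values of `r` variables: each variable that has
received a value contributes at most `k` to the radius. -/
structure SearchInv (r : ℕ) (s : SearchState k) : Prop where
  total : s.1 + s.2.2.length = r
  radius : s.2.1 + k * s.1 ≤ k * r

/-- A measure that decreases along the local search. -/
def height (s : SearchState k) : ℕ := (k + 1) * s.1 + s.2.1

theorem searchInv_start (r : ℕ) : SearchInv r ((r, 0, []) : SearchState k) := ⟨rfl, by simp⟩

theorem SearchInv.of_mem_extensions (hs : SearchInv r s) (hb : 0 < b) (hbs : b ≤ s.1)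
    (hl : IsCoveringCode b e l) (ht : t ∈ extensions b e l s) :
    SearchInv r t ∧ height t < height s := by
  obtain ⟨htotal, hradius⟩ := hs
  obtain ⟨c, hc, rfl⟩ := List.mem_map.1 ht
  obtain ⟨m, hm⟩ := Nat.exists_eq_add_of_le hbs
  have hlength := hl.length_eq c hc
  have he := hl.radius_le
  rw [hm, mul_add] at hradius
  refine ⟨⟨?_, ?_⟩, ?_⟩ <;>
    simp only [hm, Nat.add_sub_cancel_left, List.length_append, height, mul_add, add_mul] <;> omega

theorem exists_mem_extensions_dirDist_le {x : ℕ → Fin k} (hl : IsCoveringCode b e l)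
    (hdist : dirDist x s.1 s.2.2 ≤ s.2.1) (hbs : b ≤ s.1) :
    ∃ t ∈ extensions b e l s, dirDist x t.1 t.2.2 ≤ t.2.1 := by
  obtain ⟨c, hc, hcover⟩ := hl.covers x (s.1 - b)
  refine ⟨_, List.mem_map.2 ⟨c, hc, rfl⟩, ?_⟩
  dsimp only
  rw [dirDist_append, hl.length_eq c hc, Nat.sub_add_cancel hbs]
  omega

end Extensions

section Search

variable {k : ℕ} [NeZero k]

/-- The values `a` of the variables `0, 1, …` violate the constraint `c`. -/
def violated (a : List (Fin k)) (c : RawConstraint k) : Bool :=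
  c.all fun p => a.getD p.1 0 == p.2

/-- The first constraint that is violated by `a`, or the empty constraint if there is none. -/
def firstViolated (X : List (RawConstraint k)) (a : List (Fin k)) : RawConstraint k :=
  (X.filter fun c => violated a c).headD []

/-- The acceptance test of the local search: all variables have values, which violate no
constraint. -/
def accepting (X : List (RawConstraint k)) (s : SearchState k) : Bool :=
  s.1 == 0 && (X.filter fun c => violated s.2.2 c).isEmpty

/-- The values `a` with the value of the variable `i` increased by one, cyclically. -/
def increment (a : List (Fin k)) (i : ℕ) : List (Fin k) := a.set i (a.getD i 0 + 1)

/-- The branching over the variables of a violated constraint, one of which has the wrong value. -/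
def corrections (X : List (RawConstraint k)) (s : SearchState k) : List (SearchState k) :=
  bif s.2.1 == 0 then [] else
    (firstViolated X s.2.2).map fun p => (s.1, s.2.1 - 1, increment s.2.2 p.1)

/-- The children of a state in the local search for a solution of `X`, which uses the code `l` of
length `b` and radius `e` as long as there are `b` variables without a value, and the code of all
words of length one for the others. -/
def children (b e : ℕ) (l : List (List (Fin k))) (X : List (RawConstraint k))
    (s : SearchState k) : List (SearchState k) :=
  bif s.1 == 0 then corrections X s else
    bif Nat.ble b s.1 then extensions b e l s else
      extensions 1 0 ((List.finRange k).map fun v => [v]) s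

namespace PolyTime

variable {A : Type} [Enc A] {X : A → List (RawConstraint k)} {s : A → SearchState k}

@[fun_prop]
theorem violated {a : A → List (Fin k)} {c : A → RawConstraint k} (ha : PolyTime a)
    (hc : PolyTime c) : PolyTime fun x => violated (a x) (c x) := by
  unfold BallSat.violated
  fun_prop

@[fun_prop]
theorem firstViolated {a : A → List (Fin k)} (hX : PolyTime X) (ha : PolyTime a) :
    PolyTime fun x => firstViolated (X x) (a x) := by
  unfold BallSat.firstViolated
  fun_prop

theorem accepting (hX : PolyTime X) (hs : PolyTime s) :
    PolyTime fun x => accepting (X x) (s x) := by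
  unfold BallSat.accepting
  fun_prop

@[fun_prop]
theorem increment {a : A → List (Fin k)} {i : A → ℕ} (ha : PolyTime a) (hi : PolyTime i) :
    PolyTime fun x => increment (a x) (i x) :=
  ha.set hi (comp_fin (· + 1) (ha.getD hi (const 0)))

@[fun_prop]
theorem corrections (hX : PolyTime X) (hs : PolyTime s) :
    PolyTime fun x => corrections (X x) (s x) := by
  unfold BallSat.corrections
  fun_prop

theorem children (b e : ℕ) (l : List (List (Fin k))) (hX : PolyTime X) (hs : PolyTime s) :
    PolyTime fun x => children b e l (X x) (s x) := by
  unfold BallSat.children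
  fun_prop

end PolyTime

variable {b e r : ℕ} {l : List (List (Fin k))} {X : List (RawConstraint k)} {s t : SearchState k}

theorem violated_iff {a : List (Fin k)} {c : RawConstraint k} :
    violated a c = true ↔ ∀ p ∈ c, a.getD p.1 0 = p.2 := by
  simp [violated]

theorem accepting_iff : accepting X s = true ↔ s.1 = 0 ∧ ∀ c ∈ X, ¬violated s.2.2 c = true := by
  simp [accepting]

theorem satisfiesAll_of_accepting (h : accepting X s = true) :
    SatisfiesAll (fun i => s.2.2.getD i 0) X := by
  intro c hc
  simpa [violated_iff] using (accepting_iff.1 h).2 c hc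

theorem firstViolated_mem (h : accepting X s = false) (hs : s.1 = 0) :
    firstViolated X s.2.2 ∈ X ∧ violated s.2.2 (firstViolated X s.2.2) = true := by
  rw [← List.mem_filter (p := fun c => violated s.2.2 c), firstViolated]
  cases hfilter : X.filter fun c => violated s.2.2 c with
  | nil => simp [accepting, hs, hfilter] at h
  | cons c l => exact List.mem_cons_self

theorem mem_corrections : t ∈ corrections X s ↔ s.2.1 ≠ 0 ∧ ∃ p ∈ firstViolated X s.2.2,
    (s.1, s.2.1 - 1, increment s.2.2 p.1) = t := by
  unfold corrections
  cases h : s.2.1 == 0 <;> simp_all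

theorem children_cases (b e : ℕ) (l : List (List (Fin k))) (X : List (RawConstraint k))
    (s : SearchState k) :
    s.1 = 0 ∧ children b e l X s = corrections X s ∨
      b ≤ s.1 ∧ children b e l X s = extensions b e l s ∨
      (0 < s.1 ∧ s.1 < b) ∧
        children b e l X s = extensions 1 0 ((List.finRange k).map fun v => [v]) s := by
  unfold children
  cases h₀ : s.1 == 0 with
  | true => exact .inl ⟨by simpa using h₀, rfl⟩
  | false =>
    cases hb : Nat.ble b s.1 with
    | true => exact .inr (.inl ⟨Nat.le_of_ble_eq_true hb, rfl⟩)
    | false =>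
      have hpos : 0 < s.1 := Nat.pos_of_ne_zero (by simpa using h₀)
      have hlt : s.1 < b := not_le.1 (Nat.not_le_of_not_ble_eq_true (by simp [hb]))
      exact .inr (.inr ⟨⟨hpos, hlt⟩, rfl⟩)

theorem SearchInv.of_mem_corrections (hs : SearchInv r s) (ht : t ∈ corrections X s) :
    SearchInv r t ∧ height t < height s := by
  obtain ⟨htotal, hradius⟩ := hs
  obtain ⟨he, p, -, rfl⟩ := mem_corrections.1 ht
  refine ⟨⟨by simpa [increment] using htotal, by dsimp only; omega⟩, ?_⟩
  dsimp only [height]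
  omega

theorem SearchInv.of_mem_children (hs : SearchInv r s) (hb : 0 < b) (hl : IsCoveringCode b e l)
    (ht : t ∈ children b e l X s) : SearchInv r t ∧ height t < height s := by
  obtain ⟨-, h⟩ | ⟨hbs, h⟩ | ⟨⟨hpos, -⟩, h⟩ := children_cases b e l X s <;> rw [h] at ht
  · exact hs.of_mem_corrections ht
  · exact hs.of_mem_extensions hb hbs hl ht
  · exact hs.of_mem_extensions one_pos hpos isCoveringCode_finRange ht

theorem val_sub_add_one {u v : Fin k} (h : u ≠ v) :
    (u - (v + 1)).val + 1 = (u - v).val := by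
  rw [← sub_sub, Fin.val_sub_one_of_ne_zero (sub_ne_zero.2 h)]
  have := Fin.val_ne_zero_iff.2 (sub_ne_zero.2 h)
  omega

theorem dirDist_increment_add_one (x : ℕ → Fin k) (m : ℕ) {a : List (Fin k)} {i : ℕ}
    (hi : i < a.length) (hne : x (m + i) ≠ a.getD i 0) :
    dirDist x m (increment a i) + 1 = dirDist x m a := by
  induction a generalizing m i with
  | nil => simp at hi
  | cons v a ih =>
    cases i with
    | zero =>
      have := val_sub_add_one (u := x m) (v := v) (by simpa using hne)
      simp only [increment, List.set_cons_zero, List.getD_cons_zero, dirDist]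
      omega
    | succ i =>
      have := ih (m + 1) (i := i) (by simpa using hi) (by simpa [add_assoc, add_comm 1] using hne)
      simp only [increment, List.set_cons_succ, List.getD_cons_succ, dirDist] at this ⊢
      omega

theorem exists_mem_corrections_dirDist_le {x : ℕ → Fin k} {w : ℕ} (hX : ∀ c ∈ X, Valid w r c)
    (hx : SatisfiesAll x X) (hs : SearchInv r s) (hdist : dirDist x s.1 s.2.2 ≤ s.2.1)
    (hs₀ : s.1 = 0) (h : accepting X s = false) :
    ∃ t ∈ corrections X s, dirDist x t.1 t.2.2 ≤ t.2.1 := by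
  obtain ⟨hc, hviolated⟩ := firstViolated_mem h hs₀
  obtain ⟨p, hp, hne⟩ := hx _ hc
  have hlength := hs.total
  have hvar := (hX _ hc).2 p hp
  have := dirDist_increment_add_one x s.1 (a := s.2.2) (i := p.1) (by omega)
    (by rwa [hs₀, zero_add, violated_iff.1 hviolated p hp])
  exact ⟨_, mem_corrections.2 ⟨by omega, p, hp, rfl⟩, by dsimp only; omega⟩

theorem reaches_start_iff (hb : 0 < b) (hl : IsCoveringCode b e l) {w : ℕ}
    (hX : ∀ c ∈ X, Valid w r c) :
    Reaches (accepting X) (children b e l X) (r, 0, []) ↔ ∃ x, SatisfiesAll x X := by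
  constructor
  · rintro ⟨s, -, hs⟩
    exact ⟨_, satisfiesAll_of_accepting hs⟩
  · rintro ⟨x, hx⟩
    refine reaches_of_forall_exists_lt (p := fun s => SearchInv r s ∧ dirDist x s.1 s.2.2 ≤ s.2.1)
      height (fun s ⟨hs, hdist⟩ => ?_) ⟨searchInv_start r, le_rfl⟩
    cases haccepting : accepting X s with
    | true => exact .inl rfl
    | false =>
      suffices ∃ t ∈ children b e l X s, dirDist x t.1 t.2.2 ≤ t.2.1 by
        obtain ⟨t, ht, hdist⟩ := this
        obtain ⟨hinv, hlt⟩ := hs.of_mem_children hb hl ht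
        exact .inr ⟨t, ht, ⟨hinv, hdist⟩, hlt⟩
      obtain ⟨hs₀, h⟩ | ⟨hbs, h⟩ | ⟨⟨hpos, -⟩, h⟩ := children_cases b e l X s <;> rw [h]
      · exact exists_mem_corrections_dirDist_le hX hx hs hdist hs₀ haccepting
      · exact exists_mem_extensions_dirDist_le hl hdist hbs
      · exact exists_mem_extensions_dirDist_le isCoveringCode_finRange hdist hpos

end Search

/-! ### The number of nodes -/

/-- An upper bound for the number of leaves of the local search below a state, where `N` bounds
the number of leaves that are due to the choice of the values of `b` variables. -/
def leafBound {k : ℕ} (b N : ℕ) (s : SearchState k) : ℕ := N ^ (s.1 / b) * k ^ (s.1 % b) * k ^ s.2.1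

section NodeBound

variable {k b e r : ℕ} {l : List (List (Fin k))} {X : List (RawConstraint k)} {s : SearchState k}

theorem sum_leafBound_extensions (hb : 0 < b) (hbs : b ≤ s.1) :
    ((extensions b e l s).map (leafBound b (l.length * k ^ e))).sum =
      leafBound b (l.length * k ^ e) s := by
  obtain ⟨m, hm⟩ := Nat.exists_eq_add_of_le hbs
  simp only [extensions, List.map_map, Function.comp_def, leafBound, List.map_const',
    List.sum_replicate, smul_eq_mul, hm, Nat.add_sub_cancel_left, Nat.add_div_left m hb,
    Nat.add_mod_left]
  ring

theorem sum_leafBound_extensions_finRange (N : ℕ) (hpos : 0 < s.1) (hlt : s.1 < b) :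
    ((extensions 1 0 ((List.finRange k).map fun v => [v]) s).map (leafBound b N)).sum =
      leafBound b N s := by
  obtain ⟨m, hm⟩ := Nat.exists_eq_add_one_of_ne_zero hpos.ne'
  simp only [extensions, List.map_map, Function.comp_def, leafBound, List.map_const',
    List.sum_replicate, smul_eq_mul, hm, List.length_finRange, Nat.add_sub_cancel, Nat.add_zero]
  rw [Nat.div_eq_of_lt (by omega), Nat.div_eq_of_lt (by omega), Nat.mod_eq_of_lt (by omega),
    Nat.mod_eq_of_lt (by omega)]
  ring

theorem length_firstViolated_le [NeZero k] {w : ℕ} (hX : ∀ c ∈ X, Valid w r c)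
    (a : List (Fin k)) : (firstViolated X a).length ≤ w := by
  unfold firstViolated
  cases h : X.filter fun c => violated a c with
  | nil => exact Nat.zero_le _
  | cons c l =>
    exact (hX c (List.mem_filter.1 (h ▸ List.mem_cons_self : c ∈ X.filter _)).1).1

theorem sum_leafBound_corrections [NeZero k] (hX : ∀ c ∈ X, Valid k r c) (b N : ℕ)
    (s : SearchState k) :
    ((corrections X s).map (leafBound b N)).sum ≤ leafBound b N s := by
  unfold corrections
  cases h : s.2.1 == 0 with
  | true => simp
  | false =>
    obtain ⟨e, he⟩ := Nat.exists_eq_add_one_of_ne_zero (by simpa using h : s.2.1 ≠ 0)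
    have hlength : (firstViolated X s.2.2).length ≤ k := length_firstViolated_le hX _
    simp only [cond_false, List.map_map, Function.comp_def, leafBound, List.map_const',
      List.sum_replicate, smul_eq_mul, he, Nat.add_sub_cancel]
    calc (firstViolated X s.2.2).length * (N ^ (s.1 / b) * k ^ (s.1 % b) * k ^ e)
        ≤ k * (N ^ (s.1 / b) * k ^ (s.1 % b) * k ^ e) := by gcongr
      _ = N ^ (s.1 / b) * k ^ (s.1 % b) * k ^ (e + 1) := by ring

theorem sum_leafBound_children [NeZero k] (hb : 0 < b) (hX : ∀ c ∈ X, Valid k r c)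
    (s : SearchState k) :
    ((children b e l X s).map (leafBound b (l.length * k ^ e))).sum ≤
      leafBound b (l.length * k ^ e) s := by
  obtain ⟨-, h⟩ | ⟨hbs, h⟩ | ⟨⟨hpos, hlt⟩, h⟩ := children_cases b e l X s <;> rw [h]
  · exact sum_leafBound_corrections hX b _ s
  · exact (sum_leafBound_extensions hb hbs).le
  · exact (sum_leafBound_extensions_finRange _ hpos hlt).le

/-- Each leaf of the local search accounts for the nodes on the path to it, whose number is bounded
by the height. -/
def nodeBound (b N : ℕ) (s : SearchState k) : ℕ := leafBound b N s * (height s + 1)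

theorem sum_nodeBound_children [NeZero k] (hb : 0 < b) (hl : IsCoveringCode b e l)
    (hX : ∀ c ∈ X, Valid k r c) (hs : SearchInv r s) :
    ((children b e l X s).map (nodeBound b (l.length * k ^ e))).sum + 1 ≤
      nodeBound b (l.length * k ^ e) s := by
  let N := l.length * k ^ e
  have hN : 0 < N := by
    obtain ⟨c, hc, -⟩ := hl.covers 0 0
    exact mul_pos (List.length_pos_of_mem hc) (pow_pos (NeZero.pos k) e)
  have hleaf : 0 < leafBound b N s := by
    have := NeZero.pos k
    unfold leafBound
    positivity
  calc ((children b e l X s).map (nodeBound b N)).sum + 1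
      ≤ ((children b e l X s).map fun t => leafBound b N t * height s).sum + 1 := by
        gcongr
        refine List.sum_le_sum fun t ht => ?_
        exact Nat.mul_le_mul_left _ (hs.of_mem_children hb hl ht).2
    _ = ((children b e l X s).map (leafBound b N)).sum * height s + 1 := by
        rw [List.sum_map_mul_right]
    _ ≤ leafBound b N s * height s + leafBound b N s := by
        gcongr
        · exact sum_leafBound_children hb hX s
        · exact hleaf
    _ = nodeBound b N s := (mul_add_one _ _).symm

theorem nodeBound_start_le [NeZero k] {c : ℝ} (hb : 0 < b) (hc : 1 ≤ c) {N : ℕ}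
    (hN : (N : ℝ) ≤ c ^ b) (r : ℕ) :
    (nodeBound b N ((r, 0, []) : SearchState k) : ℝ) ≤ k ^ b * ((k + 1) * r + 1) * c ^ r := by
  have hk : (1 : ℝ) ≤ k := mod_cast NeZero.one_le
  have hmod := (Nat.mod_lt r hb).le
  have hdiv := Nat.mul_div_le r b
  simp only [nodeBound, leafBound, height, pow_zero, mul_one, add_zero]
  push_cast
  calc (N : ℝ) ^ (r / b) * k ^ (r % b) * ((k + 1) * r + 1)
      ≤ (c ^ b) ^ (r / b) * k ^ b * ((k + 1) * r + 1) := by gcongr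
    _ = k ^ b * ((k + 1) * r + 1) * c ^ (b * (r / b)) := by rw [← pow_mul]; ring
    _ ≤ k ^ b * ((k + 1) * r + 1) * c ^ r := by gcongr

theorem one_le_div_sum_inv_pow (k : ℕ) [NeZero k] :
    (1 : ℝ) ≤ k / ∑ v : Fin k, (k : ℝ)⁻¹ ^ (v : ℕ) := by
  have hk : (1 : ℝ) ≤ k := mod_cast NeZero.one_le
  refine (one_le_div (Finset.sum_pos (fun v _ => by positivity) Finset.univ_nonempty)).2 ?_
  calc ∑ v : Fin k, (k : ℝ)⁻¹ ^ (v : ℕ) ≤ ∑ _v : Fin k, (1 : ℝ) :=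
        Finset.sum_le_sum fun v _ => pow_le_one₀ (by positivity) (inv_le_one_of_one_le₀ hk)
    _ = k := by simp

theorem SearchInv.encSize_le (hs : SearchInv r s) : encSize s ≤ r + k * r + r * (k + 1) + 2 := by
  obtain ⟨m, e, a⟩ := s
  obtain ⟨htotal, hradius⟩ := hs
  dsimp only at htotal hradius
  have ha : encSize a ≤ a.length * (k + 1) :=
    encSize_le_length_mul fun v _ => by rw [encSize_fin]; exact v.2.le
  have hlength : a.length * (k + 1) ≤ r * (k + 1) := Nat.mul_le_mul_right _ (by omega)
  simp only [encSize_mk, encSize_nat]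
  omega

end NodeBound

/-! ### Programs on the instances -/

theorem Formula.IsCNF.card_le {n k : ℕ} {F : Formula n} (hF : F.IsCNF k) :
    F.card ≤ (k + 1) * (2 * n + 1) ^ k := by
  have hF' : F ⊆ (Finset.range (k + 1)).biUnion fun j => Finset.powersetCard j Finset.univ := by
    intro C hC
    have := hF C hC
    simp only [Finset.mem_biUnion, Finset.mem_range, Finset.mem_powersetCard_univ]
    exact ⟨C.card, by omega, rfl⟩
  calc F.card
      ≤ ∑ j ∈ Finset.range (k + 1), (Finset.powersetCard j (Finset.univ : Clause n)).card :=
        (Finset.card_le_card hF').trans Finset.card_biUnion_le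
    _ ≤ ∑ _j ∈ Finset.range (k + 1), (2 * n + 1) ^ k := by
        refine Finset.sum_le_sum fun j hj => ?_
        rw [Finset.card_powersetCard, Finset.card_univ, Fintype.card_prod, Fintype.card_fin,
          Fintype.card_bool, mul_comm]
        calc (2 * n).choose j ≤ (2 * n) ^ j := Nat.choose_le_pow _ _
          _ ≤ (2 * n + 1) ^ j := by gcongr; omega
          _ ≤ (2 * n + 1) ^ k := by
              have := Finset.mem_range_succ_iff.1 hj
              gcongr
              omega
    _ = (k + 1) * (2 * n + 1) ^ k := by simp

namespace Instance

variable {k : ℕ}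

instance : Enc (Instance k) := ⟨fun I => encInstance I.n I.L I.α I.r⟩

theorem polyTime_raw : PolyTime (raw : Instance k → RawInstance) :=
  PolyTime.id.of_enc_eq enc_raw

variable (I : Instance k)

theorem r_le [NeZero k] : I.r ≤ I.n := by
  simpa using Fintype.card_le_of_injective (fun i => (I.falseLiteral i 0).1) fun i i' h =>
    (I.falseLiteral_fst_injective h).1

theorem length_L_le : I.L.length ≤ (k + 1) * (2 * I.n + 1) ^ k := by
  rw [← List.length_map (f := List.toFinset), ← List.toFinset_card_of_nodup I.listsOnce.2.1,
    I.listsOnce.1]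
  exact I.isCNF.card_le

theorem encSize_le [NeZero k] : encSize I ≤
    I.n + I.n + I.n * 2 + (k + 1) * (2 * I.n + 1) ^ k * (k * (I.n + 3) + 1) + 3 := by
  have hα : encSize (List.ofFn I.α) ≤ I.n * 2 := by
    simpa using encSize_le_length_mul (l := List.ofFn I.α) fun b _ => encSize_bool_le b
  have hliteral (l : Literal I.n) : encSize l.raw ≤ I.n + 2 := by
    have := encSize_bool_le l.2
    simp only [Literal.raw, encSize_mk, encSize_nat]
    omega
  have hclause : ∀ C ∈ I.L.map (List.map Literal.raw), encSize C ≤ k * (I.n + 3) := by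
    refine List.forall_mem_map.2 fun C hC => ?_
    refine (encSize_le_length_mul (List.forall_mem_map.2 fun l _ => hliteral l)).trans ?_
    rw [List.length_map]
    exact Nat.mul_le_mul_right _ (I.length_le_of_mem hC)
  have hlength : (I.L.map (List.map Literal.raw)).length ≤ (k + 1) * (2 * I.n + 1) ^ k := by
    rw [List.length_map]
    exact I.length_L_le
  have hL := (encSize_le_length_mul hclause).trans (Nat.mul_le_mul_right _ hlength)
  have hraw : encSize I = encSize I.raw := congrArg Data.size I.enc_raw.symm
  have hr := I.r_le
  rw [hraw]
  simp only [raw, encSize_mk, encSize_nat]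
  omega

theorem polyBounded_encSize [NeZero k] :
    PolyBounded (fun I : Instance k => I.n) fun I => encSize I := by
  refine ⟨.X + .X + .X * 2 + (.C k + 1) * (2 * .X + 1) ^ k * (.C k * (.X + 3) + 1) + 3,
    fun I => I.encSize_le.trans_eq ?_⟩
  simp

theorem exists_program {B : Type} [Enc B] {f : Instance k → B} {T : Instance k → ℕ}
    (hf : ComputableInTime f T) :
    ∃ P : Program, ∀ I, ∃ t ≤ T I + 2, P.Outputs (enc I) (enc (f I)) t := by
  obtain ⟨Q, e, hf⟩ := hf 1
  refine ⟨e :: Q, fun I => ?_⟩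
  obtain ⟨t, ht, h⟩ := EvaluatesIn.arg.call (f := 0) rfl (hf (e :: Q) List.prefix_rfl I)
  exact ⟨t, by omega, h⟩

theorem polyTime_reduction : PolyTime fun I : Instance k => reduction k I.raw :=
  (PolyTime.reduction k).comp polyTime_raw

theorem exists_reduction_program (k : ℕ) [NeZero k] :
    ∃ (P : Program) (p : Polynomial ℕ), ∀ I : Instance k, ∃ t ≤ p.eval I.n,
      P.Outputs (enc I) (enc (reduction k I.raw)) t := by
  obtain ⟨-, T, hT, hreduction⟩ := polyTime_reduction (k := k)
  obtain ⟨P, hP⟩ := exists_program hreduction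
  obtain ⟨p, hp⟩ := (polyBounded_encSize.trans hT).add (.const _ 2)
  refine ⟨P, p, fun I => ?_⟩
  obtain ⟨t, ht, h⟩ := hP I
  exact ⟨t, ht.trans (hp I), h⟩

theorem reaches_start_iff_inBall [NeZero k] {b e : ℕ} {l : List (List (Fin k))} (hb : 0 < b)
    (hl : IsCoveringCode b e l) : (∃ s ∈ [((I.raw.2.1, 0, []) : SearchState k)],
      Reaches (accepting (reduction k I.raw).2) (children b e l (reduction k I.raw).2) s) ↔
        InBall I.F I.α I.r := by
  simp only [List.mem_singleton, exists_eq_left]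
  exact (reaches_start_iff hb hl I.valid_reduction).trans I.satisfiable_reduction_iff

open Classical in
theorem exists_computableInTime_decide [NeZero k] {b e : ℕ} {l : List (List (Fin k))} (hb : 0 < b)
    (hl : IsCoveringCode b e l) :
    ∃ V M : Instance k → ℕ, PolyBounded (fun I : Instance k => I.n) V ∧
      PolyBounded (fun I : Instance k => I.n) M ∧
      ComputableInTime (fun I : Instance k => decide (InBall I.F I.α I.r)) fun I =>
        V I + nodeBound b (l.length * k ^ e) ((I.r, 0, []) : SearchState k) * M I := by
  have hr : PolyTime fun I : Instance k => I.raw.2.1 := polyTime_raw.snd.fst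
  have hr' : PolyBounded (encSize (A := Instance k)) fun I => I.r :=
    hr.1.of_le fun I => (encSize_nat I.r).ge
  have hσ : PolyBounded (encSize (A := Instance k)) fun I =>
      I.r + k * I.r + I.r * (k + 1) + 2 :=
    ((hr'.add ((PolyBounded.const _ k).mul hr')).add (hr'.mul (.const _ (k + 1)))).add (.const _ 2)
  obtain ⟨V, M, hV, hM, h⟩ := PolyTime.exists_computableInTime_search
    (Inv := fun I s => SearchInv I.r s) (W := fun _ => nodeBound b (l.length * k ^ e))
    (PolyTime.accepting (.fst .id) (.snd .id)) (PolyTime.children b e l (.fst .id) (.snd .id))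
    polyTime_reduction.snd ((hr.prodMk (.const (0, []))).cons (.const [])) hσ
    (fun I s hs => hs.encSize_le) (fun I => List.forall_mem_singleton.2 (searchInv_start I.r))
    (fun I s (hs : SearchInv I.r s) t ht => (hs.of_mem_children hb hl ht).1)
    (fun I s hs => sum_nodeBound_children hb hl I.valid_reduction hs)
  refine ⟨V, M, polyBounded_encSize.trans hV, polyBounded_encSize.trans hM, ?_⟩
  simp only [reaches_start_iff_inBall _ hb hl] at h
  exact h

open Classical in
theorem exists_decision_program [NeZero k] {c : ℝ}
    (hc : k / ∑ v : Fin k, (k : ℝ)⁻¹ ^ (v : ℕ) < c) :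
    ∃ (P : Program) (p : Polynomial ℕ), ∀ I : Instance k, ∃ t : ℕ,
      (t : ℝ) ≤ (p.eval I.n : ℕ) * c ^ I.r ∧
        P.Outputs (enc I) (enc (decide (InBall I.F I.α I.r))) t := by
  obtain ⟨b, e, l, hb, hl, hlength⟩ := exists_isCoveringCode hc
  obtain ⟨V, M, hV, hM, h⟩ := exists_computableInTime_decide hb hl
  obtain ⟨P, hP⟩ := exists_program h
  have hr : PolyBounded (fun I : Instance k => I.n) fun I => I.r :=
    (PolyBounded.refl _).of_le fun I => I.r_le
  obtain ⟨p, hp⟩ := (hV.add (((PolyBounded.const _ (k ^ b)).mul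
    (((PolyBounded.const _ (k + 1)).mul hr).add (.const _ 1))).mul hM)).add (.const _ 2)
  refine ⟨P, p, fun I => ?_⟩
  obtain ⟨t, ht, h⟩ := hP I
  refine ⟨t, ?_, h⟩
  have hc' : 1 ≤ c := (one_le_div_sum_inv_pow k).trans hc.le
  have hnodes := nodeBound_start_le (k := k) (N := l.length * k ^ e) hb hc' (mod_cast hlength) I.r
  have hone : 1 ≤ c ^ I.r := one_le_pow₀ hc'
  calc (t : ℝ)
      ≤ V I + nodeBound b (l.length * k ^ e) ((I.r, 0, []) : SearchState k) * M I + 2 :=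
        mod_cast ht
    _ ≤ V I * c ^ I.r + k ^ b * ((k + 1) * I.r + 1) * c ^ I.r * M I + 2 * c ^ I.r := by
        gcongr
        · exact le_mul_of_one_le_right (by positivity) hone
        · linarith
    _ = (V I + k ^ b * ((k + 1) * I.r + 1) * M I + 2 : ℕ) * c ^ I.r := by push_cast; ring
    _ ≤ (p.eval I.n : ℕ) * c ^ I.r := by
        gcongr
        exact hp I

end Instance

/-! ### Constraints over a finite set of variables -/

section CSP

variable {k r : ℕ}

/-- A literal of a CSP formula in the data of a program. -/
def rawCSPLiteral (p : Fin r × Fin k) : ℕ × Fin k := (p.1, p.2)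

theorem exists_map_rawCSPLiteral {w : ℕ} {X : List (RawConstraint k)}
    (hX : ∀ c ∈ X, Valid w r c) :
    ∃ L : List (List (Fin r × Fin k)), L.map (List.map rawCSPLiteral) = X := by
  change X ∈ Set.range (List.map (List.map rawCSPLiteral))
  rw [Set.range_list_map, Set.mem_ofPred_eq]
  intro c hc
  rw [Set.range_list_map, Set.mem_ofPred_eq]
  rintro ⟨i, j⟩ hp
  exact ⟨(⟨i, (hX c hc).2 _ hp⟩, j), rfl⟩

theorem enc_map_rawCSPLiteral (L : List (List (Fin r × Fin k))) :
    enc (r, L.map (List.map rawCSPLiteral)) = encCSP k r L := by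
  change Data.cons _ (encList (encList enc) (L.map (List.map rawCSPLiteral))) = _
  simp only [encList_map]
  rfl

theorem satisfiable_iff [NeZero k] (L : List (List (Fin r × Fin k))) :
    CSP.Satisfiable (L.map List.toFinset).toFinset ↔
      ∃ A, SatisfiesAll A (L.map (List.map rawCSPLiteral)) := by
  simp only [CSP.Satisfiable, SatisfiesAll, List.mem_toFinset, List.mem_map,
    forall_exists_index, and_imp, forall_apply_eq_imp_iff₂, exists_exists_and_eq_and,
    rawCSPLiteral]
  constructor
  · rintro ⟨a, ha⟩
    exact ⟨fun i => if h : i < r then a ⟨i, h⟩ else 0, by simpa using ha⟩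
  · rintro ⟨A, hA⟩
    exact ⟨fun i => A i, hA⟩

theorem enc_decide_ne_nil_iff (q : Prop) [Decidable q] : enc (decide q) ≠ Data.nil ↔ q := by
  by_cases h : q <;> simp [h, enc, encBool]

theorem Instance.exists_csp [NeZero k] (I : Instance k) :
    ∃ (G : CSP k I.r) (L : List (List (Fin I.r × Fin k))), G.HasWidth k ∧
      (G.Satisfiable ↔ InBall I.F I.α I.r) ∧ Lists L G ∧
        encCSP k I.r L = enc (reduction k I.raw) := by
  obtain ⟨L, hL⟩ := exists_map_rawCSPLiteral I.valid_reduction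
  refine ⟨_, L, fun C hC => ?_, ?_, rfl, ?_⟩
  · obtain ⟨c, hc, rfl⟩ := List.mem_map.1 (List.mem_toFinset.1 hC)
    have hvalid := I.valid_reduction (c.map rawCSPLiteral) (hL ▸ List.mem_map_of_mem hc)
    exact (List.toFinset_card_le c).trans (c.length_map _ ▸ hvalid.1)
  · rw [satisfiable_iff, hL, I.satisfiable_reduction_iff]
  · rw [← enc_map_rawCSPLiteral, hL]
    rfl

end CSP

theorem lemma2_general (k : ℕ) [NeZero k] (c : ℝ)
    (hc : k / ∑ v : Fin k, (k : ℝ)⁻¹ ^ (v : ℕ) < c) :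
    (∃ (P : Program) (p : Polynomial ℕ),
      ∀ (n : ℕ) (F : Formula n) (α : Assignment n) (r : ℕ),
        F.IsCNF k → F.NegDisjointOfCard k α r →
        ∀ L : List (List (Literal n)), ListsOnce L F →
          ∃ (G : CSP k r) (L' : List (List (Fin r × Fin k))) (t : ℕ),
            G.HasWidth k ∧ (G.Satisfiable ↔ InBall F α r) ∧
            Lists L' G ∧ P.Outputs (encInstance n L α r) (encCSP k r L') t ∧
            t ≤ p.eval n) ∧
    (∃ (P : Program) (p : Polynomial ℕ),
      ∀ (n : ℕ) (F : Formula n) (α : Assignment n) (r : ℕ),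
        F.IsCNF k → F.NegDisjointOfCard k α r →
        ∀ L : List (List (Literal n)), ListsOnce L F →
          ∃ (v : Data) (t : ℕ),
            P.Outputs (encInstance n L α r) v t ∧ (v ≠ Data.nil ↔ InBall F α r) ∧
            (t : ℝ) ≤ ((p.eval n : ℕ) : ℝ) * c ^ r) := by
  constructor
  · obtain ⟨P, p, h⟩ := Instance.exists_reduction_program k
    refine ⟨P, p, fun n F α r hF hN L hL => ?_⟩
    let I : Instance k := ⟨n, F, α, r, hF, hN, L, hL⟩
    obtain ⟨t, ht, hP⟩ := h I
    obtain ⟨G, L', hwidth, hG, hL', henc⟩ := I.exists_csp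
    exact ⟨G, L', t, hwidth, hG, hL', henc ▸ hP, ht⟩
  · classical
    obtain ⟨P, p, h⟩ := Instance.exists_decision_program hc
    refine ⟨P, p, fun n F α r hF hN L hL => ?_⟩
    obtain ⟨t, ht, hP⟩ := h ⟨n, F, α, r, hF, hN, L, hL⟩
    exact ⟨_, t, hP, enc_decide_ne_nil_iff _, ht⟩

end BallSat

open BallSat in
/-- On the instances `(F, α, r)` of Ball-3-SAT for which `Neg(F)` consists of exactly `r` pairwise
disjoint 3-clauses: a program reduces them in polynomial time to (3,3)-CSP formulas over `r`
ternary variables, and a program decides them in time `O*(2.077 ^ r)`. -/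
theorem lemma2 :
    (∃ (P : Program) (p : Polynomial ℕ),
      ∀ (n : ℕ) (F : Formula n) (α : Assignment n) (r : ℕ),
        F.IsCNF 3 → F.NegDisjoint α r →
        ∀ L : List (List (Literal n)), ListsOnce L F →
          ∃ (G : CSP 3 r) (L' : List (List (Fin r × Fin 3))) (t : ℕ),
            G.HasWidth 3 ∧ (G.Satisfiable ↔ InBall F α r) ∧
            Lists L' G ∧ P.Outputs (encInstance n L α r) (encCSP 3 r L') t ∧
            t ≤ p.eval n) ∧
    (∃ (P : Program) (p : Polynomial ℕ),
      ∀ (n : ℕ) (F : Formula n) (α : Assignment n) (r : ℕ),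
        F.IsCNF 3 → F.NegDisjoint α r →
        ∀ L : List (List (Literal n)), ListsOnce L F →
          ∃ (v : Data) (t : ℕ),
            P.Outputs (encInstance n L α r) v t ∧ (v ≠ Data.nil ↔ InBall F α r) ∧
            (t : ℝ) ≤ ((p.eval n : ℕ) : ℝ) * (2.077 : ℝ) ^ r) :=
  lemma2_general 3 2.077 (by norm_num [Fin.sum_univ_three])
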